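/- Conventions. A *circle* in $\mathbb{R}^2$ is a round circle of positive radius or a straight line, together with a choice of one of the two components of its complement, called its interior. Two circles are *tangent* if they meet in exactly one point of $\mathbb{R}^2\cup\{\infty\}$, where $\infty$ lies exactly on the lines (so two lines are tangent if and only if they are parallel and distinct). An *Apollonian circle packing* is a set $\mathcal{P}$ of circles with pairwise disjoint interiors that contains three mutually tangent circles and that contains every circle which is tangent to three mutually tangent circles of $\mathcal{P}$ and whose interior is disjoint from theirs. It is a *strip packing* if two of its circles are parallel lines and all its other circles lie in the strip between them. For $\alpha>0$ let $\mathcal{P}_\alpha$ be the packing generated by the $x$-axis (with the lower half-plane as interior), the circle of curvature $\alpha^2$ tangent to and above the $x$-axis at the origin, and the circle of curvature $1$ resting on the $x$-axis and tangent on the right to the previous circle (the last two having their open discs as interiors); that is, starting from these three circles one repeatedly adds all circles that are tangent to three mutually tangent circles already present and whose interiors are disjoint from theirs, and takes the union of all stages. A *similarity* of $\mathbb{R}^2$ is a map $\Phi$ with $\|\Phi(x)-\Phi(y)\|=\mu\|x-y\|$ for some $\mu>0$ and all $x,y$; it has the form $\Phi(x)=\mu Ax+b$ with $A$ orthogonal,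 and it is *orientation-preserving* if $\det A=1$. For a packing $\mathcal{P}$ let $\operatorname{Symm}(\mathcal{P})$ be the group of all similarities $\Phi$ with $\{\Phi(C): C\in\mathcal{P}\}=\mathcal{P}$, and let $\operatorname{Symm}_+(\mathcal{P})$ be its subgroup of orientation-preserving similarities. Let $D_\infty$ denote the infinite dihedral group. **Theorem.** Let $\alpha>0$ be a real number. 1. If $\alpha\in\mathbb{Q}$, then $\mathcal{P}_\alpha$ is a strip packing, $\operatorname{Symm}(\mathcal{P}_\alpha)\cong D_\infty\times\mathbb{Z}/2\mathbb{Z}$, and $\operatorname{Symm}_+(\mathcal{P}_\alpha)\cong D_\infty$. 2. If $\alpha$ is quadratic over $\mathbb{Q}$ (that is, algebraic of degree exactly $2$), then $\operatorname{Symm}(\mathcal{P}_\alpha)\cong\mathbb{Z}$. Let $D$ be the discriminant of the primitive quadratic polynomial with integer coefficients that has $\alpha$ as a root (unique up to sign). If $x^2-Dy^2=-4$ has no solution $(x,y)\in\mathbb{Z}^2$, then $\operatorname{Symm}_+(\mathcal{P}_\alpha)=\operatorname{Symm}(\mathcal{P}_\alpha)$; if it has a solution, then $\operatorname{Symm}_+(\mathcal{P}_\alpha)$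 is the subgroup of index $2$ in $\operatorname{Symm}(\mathcal{P}_\alpha)$. 3. Otherwise $\operatorname{Symm}_+(\mathcal{P}_\alpha)=\operatorname{Symm}(\mathcal{P}_\alpha)=1$. -/

import Mathlib

namespace Apollonian

/-- The Euclidean plane. -/
abbrev Plane : Type := EuclideanSpace ℝ (Fin 2)

/-- The similarity group of the plane: bijections `Φ` with `dist (Φ x) (Φ y) = μ * dist x y` for
some `μ > 0`, under composition. -/
abbrev Similarity : Type := Plane ≃ᵈ Plane

/-! ### Circles -/

/-- `s` is a round circle of positive radius, and `u` is one of the two components of its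
complement. -/
def IsRoundWithSide (s u : Set Plane) : Prop :=
  ∃ (c : Plane) (r : ℝ), 0 < r ∧ s = Metric.sphere c r ∧
    (u = Metric.ball c r ∨ u = (Metric.closedBall c r)ᶜ)

/-- `s` is a straight line, and `u` is one of the two components of its complement (both are
obtained, since the unit normal vector `n` may be replaced by `-n`). -/
def IsLineWithSide (s u : Set Plane) : Prop :=
  ∃ (n : Plane) (t : ℝ), ‖n‖ = 1 ∧ s = {x | inner ℝ n x = t} ∧ u = {x | inner ℝ n x < t}

/-- A circle in the generalized sense: a round circle or a straight line, together with a choice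
of one of the components of its complement, called its interior. -/
@[ext]
structure PlaneCircle where
  curve : Set Plane
  interior : Set Plane
  isCircle : IsRoundWithSide curve interior ∨ IsLineWithSide curve interior

/-- The round circle with centre `c` and radius `r`, whose interior is the open disc. -/
def disc (c : Plane) (r : ℝ) (hr : 0 < r) : PlaneCircle where
  curve := Metric.sphere c r
  interior := Metric.ball c r
  isCircle := Or.inl ⟨c, r, hr, rfl, Or.inl rfl⟩

/-- The line `⟪n, x⟫ = t` with interior the half-plane `⟪n, x⟫ < t`. -/
def line (n : Plane) (t : ℝ) (hn : ‖n‖ = 1) : PlaneCircle where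
  curve := {x | inner ℝ n x = t}
  interior := {x | inner ℝ n x < t}
  isCircle := Or.inr ⟨n, t, hn, rfl, rfl⟩

/-- The circle is a straight line. -/
def PlaneCircle.IsLine (C : PlaneCircle) : Prop :=
  IsLineWithSide C.curve C.interior

/-- Two circles are tangent if they meet in exactly one point; for two straight lines that point
has to be the point at infinity, that is, the lines are parallel and distinct. -/
def Tangent (A B : PlaneCircle) : Prop :=
  (A.IsLine ∧ B.IsLine ∧ Disjoint A.curve B.curve) ∨
    (¬ (A.IsLine ∧ B.IsLine) ∧ ∃! x, x ∈ A.curve ∩ B.curve)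

/-- Tangency of circles with a chosen interior: they are tangent and their interiors are
disjoint. -/
def ExtTangent (A B : PlaneCircle) : Prop :=
  Tangent A B ∧ Disjoint A.interior B.interior

/-- Three mutually tangent circles with disjoint interiors. -/
def MutuallyTangent (A B C : PlaneCircle) : Prop :=
  ExtTangent A B ∧ ExtTangent B C ∧ ExtTangent A C

/-! ### Packings -/

/-- Apollonian circle packings. -/
structure IsApollonianPacking (P : Set PlaneCircle) : Prop where
  disjoint_interiors : ∀ A ∈ P, ∀ B ∈ P, A ≠ B → Disjoint A.interior B.interior
  exists_triple : ∃ A ∈ P, ∃ B ∈ P, ∃ C ∈ P, MutuallyTangent A B C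
  closed : ∀ A ∈ P, ∀ B ∈ P, ∀ C ∈ P, MutuallyTangent A B C →
    ∀ D : PlaneCircle, ExtTangent D A → ExtTangent D B → ExtTangent D C → D ∈ P

/-- A strip packing: an Apollonian packing containing two parallel lines such that every other
circle lies in the (closed) strip between them. -/
def IsStripPacking (P : Set PlaneCircle) : Prop :=
  IsApollonianPacking P ∧
    ∃ L₁ ∈ P, ∃ L₂ ∈ P, L₁.IsLine ∧ L₂.IsLine ∧ Disjoint L₁.curve L₂.curve ∧
      ∀ C ∈ P, C ≠ L₁ → C ≠ L₂ → C.curve ∪ C.interior ⊆ (L₁.interior ∪ L₂.interior)ᶜ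

/-- The stages of the recursive construction of a packing from a set `T` of three mutually tangent
circles with disjoint interiors: at each step all circles tangent to three mutually tangent circles
of the previous stage are added. -/
def stage (T : Set PlaneCircle) : ℕ → Set PlaneCircle
  | 0 => T
  | n + 1 => stage T n ∪
      {D | ∃ A ∈ stage T n, ∃ B ∈ stage T n, ∃ C ∈ stage T n, MutuallyTangent A B C ∧
        ExtTangent D A ∧ ExtTangent D B ∧ ExtTangent D C}

/-- The packing generated by `T`. -/
def generatedPacking (T : Set PlaneCircle) : Set PlaneCircle :=
  ⋃ n, stage T n

/-- The `x`-axis, with interior the lower half-plane. -/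
noncomputable def xAxis : PlaneCircle :=
  line (EuclideanSpace.single 1 1) 0 (by simp)

/-- The packing generated by the `x`-axis, the circle of curvature `α ^ 2` tangent to and above the
`x`-axis at the origin, and the circle of curvature `1` resting on the `x`-axis and tangent on the
right to the previous one. -/
noncomputable def packing (α : ℝ) (hα : 0 < α) : Set PlaneCircle :=
  generatedPacking
    {disc !₂[0, 1 / α ^ 2] (1 / α ^ 2) (by positivity), disc !₂[2 / α, 1] 1 one_pos, xAxis}

/-! ### The action of similarities -/

/-- A half-plane is the set of points closer to one of two given points than to the other one. -/
theorem inner_sub_eq_dist (n : Plane) (t : ℝ) (hn : ‖n‖ = 1) (x : Plane) :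
    4 * (inner ℝ n x - t) = dist x ((t - 1) • n) ^ 2 - dist x ((t + 1) • n) ^ 2 := by
  rw [dist_eq_norm, dist_eq_norm, norm_sub_sq_real, norm_sub_sq_real, norm_smul, norm_smul,
    inner_smul_right, inner_smul_right, real_inner_comm, hn]
  simp only [Real.norm_eq_abs, mul_one, sq_abs]
  ring

theorem isLineWithSide_of_dist (p q : Plane) (hpq : p ≠ q) :
    IsLineWithSide {x | dist x p = dist x q} {x | dist x p < dist x q} := by
  have h0 : 0 < ‖q - p‖ := norm_pos_iff.2 (sub_ne_zero.2 hpq.symm)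
  have key : ∀ x : Plane, dist x p ^ 2 - dist x q ^ 2 =
      2 * ‖q - p‖ * (inner ℝ (‖q - p‖⁻¹ • (q - p)) x
        - ‖q - p‖⁻¹ * ((‖q‖ ^ 2 - ‖p‖ ^ 2) / 2)) := by
    intro x
    rw [dist_eq_norm, dist_eq_norm, norm_sub_sq_real, norm_sub_sq_real, inner_smul_left,
      inner_sub_left, real_inner_comm x q, real_inner_comm x p]
    simp only [conj_trivial]
    field_simp
    ring
  refine ⟨‖q - p‖⁻¹ • (q - p), ‖q - p‖⁻¹ * ((‖q‖ ^ 2 - ‖p‖ ^ 2) / 2), ?_, ?_, ?_⟩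
  · rw [norm_smul, norm_inv, norm_norm, inv_mul_cancel₀ h0.ne']
  · ext x
    have hx := key x
    simp only [Set.mem_ofPred_eq]
    rw [← sq_eq_sq₀ dist_nonneg dist_nonneg, ← sub_eq_zero, hx, mul_eq_zero, sub_eq_zero]
    simp [h0.ne']
  · ext x
    have hx := key x
    simp only [Set.mem_ofPred_eq]
    rw [← sq_lt_sq₀ dist_nonneg dist_nonneg, ← sub_neg, hx, ← sub_neg (b := _ * _)]
    constructor
    · intro h
      by_contra h'
      exact absurd h (not_lt.2 (mul_nonneg (by positivity) (not_lt.1 h')))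
    · intro h
      exact mul_neg_of_pos_of_neg (by positivity) h

theorem dist_apply (Φ : Similarity) (x y : Plane) :
    dist (Φ x) (Φ y) = Dilation.ratio Φ * dist x y :=
  Dilation.dist_eq Φ x y

theorem image_eq_setOf (Φ : Similarity) (p : Plane → Prop) :
    Φ '' {x | p x} = {y | p (Φ.symm y)} := by
  ext y
  constructor
  · rintro ⟨x, hx, rfl⟩
    simpa using hx
  · intro hy
    exact ⟨Φ.symm y, hy, by simp⟩

theorem IsRoundWithSide.image {s u : Set Plane} (h : IsRoundWithSide s u) (Φ : Similarity) :
    IsRoundWithSide (Φ '' s) (Φ '' u) := by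
  obtain ⟨c, r, hr, rfl, hu⟩ := h
  have hm : (0 : ℝ) < Dilation.ratio Φ := by exact_mod_cast Dilation.ratio_pos Φ
  have hd : ∀ y, dist y (Φ c) = Dilation.ratio Φ * dist (Φ.symm y) c := by
    intro y
    rw [← dist_apply, DilationEquiv.apply_symm_apply]
  have hball : Φ '' Metric.ball c r = Metric.ball (Φ c) (Dilation.ratio Φ * r) := by
    rw [show Metric.ball c r = {x | dist x c < r} from rfl, image_eq_setOf]
    ext y
    simp only [Set.mem_ofPred_eq, Metric.mem_ball, hd, mul_lt_mul_iff_right₀ hm]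
  have hcl : Φ '' (Metric.closedBall c r)ᶜ =
      (Metric.closedBall (Φ c) (Dilation.ratio Φ * r))ᶜ := by
    rw [show (Metric.closedBall c r)ᶜ = {x | ¬ dist x c ≤ r} from rfl, image_eq_setOf]
    ext y
    simp only [Set.mem_ofPred_eq, Set.mem_compl_iff, Metric.mem_closedBall, hd,
      mul_le_mul_iff_right₀ hm]
  refine ⟨Φ c, Dilation.ratio Φ * r, by positivity, ?_, ?_⟩
  · rw [show Metric.sphere c r = {x | dist x c = r} from rfl, image_eq_setOf]
    ext y
    simp only [Set.mem_ofPred_eq, Metric.mem_sphere, hd, mul_right_inj' hm.ne']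
  · rcases hu with rfl | rfl
    · exact Or.inl hball
    · exact Or.inr hcl

theorem IsLineWithSide.image {s u : Set Plane} (h : IsLineWithSide s u) (Φ : Similarity) :
    IsLineWithSide (Φ '' s) (Φ '' u) := by
  obtain ⟨n, t, hn, rfl, rfl⟩ := h
  have hm : (0 : ℝ) < Dilation.ratio Φ := by exact_mod_cast Dilation.ratio_pos Φ
  have hd : ∀ y z, dist y (Φ z) = Dilation.ratio Φ * dist (Φ.symm y) z := by
    intro y z
    rw [← dist_apply, DilationEquiv.apply_symm_apply]
  have hne : Φ ((t - 1) • n) ≠ Φ ((t + 1) • n) := by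
    intro h
    have h1 : (t - 1) • n = (t + 1) • n := Φ.injective h
    have hn0 : n ≠ 0 := by
      rintro rfl
      simp at hn
    have := smul_left_injective ℝ hn0 h1
    linarith
  convert isLineWithSide_of_dist _ _ hne using 1
  · rw [image_eq_setOf]
    ext y
    simp only [Set.mem_ofPred_eq, hd, mul_right_inj' hm.ne']
    have := inner_sub_eq_dist n t hn (Φ.symm y)
    rw [← sq_eq_sq₀ dist_nonneg dist_nonneg]
    constructor <;> intro h <;> linarith
  · rw [image_eq_setOf]
    ext y
    simp only [Set.mem_ofPred_eq, hd, mul_lt_mul_iff_right₀ hm]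
    have := inner_sub_eq_dist n t hn (Φ.symm y)
    rw [← sq_lt_sq₀ dist_nonneg dist_nonneg]
    constructor <;> intro h <;> linarith

/-- The image `Φ(C)` of a circle under a similarity, with interior the image of the interior. -/
def PlaneCircle.map (Φ : Similarity) (C : PlaneCircle) : PlaneCircle where
  curve := Φ '' C.curve
  interior := Φ '' C.interior
  isCircle := C.isCircle.imp (fun h => h.image Φ) (fun h => h.image Φ)

theorem PlaneCircle.map_one (C : PlaneCircle) : C.map 1 = C := by
  ext <;> simp [PlaneCircle.map]

theorem PlaneCircle.map_mul (Φ Ψ : Similarity) (C : PlaneCircle) :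
    C.map (Φ * Ψ) = (C.map Ψ).map Φ := by
  ext <;> simp [PlaneCircle.map]

/-- The self-similarity group of a packing `P`: the similarities `Φ` with
`{Φ(C) | C ∈ P} = P`. -/
def Symm (P : Set PlaneCircle) : Subgroup Similarity where
  carrier := {Φ | PlaneCircle.map Φ '' P = P}
  one_mem' := by
    have : PlaneCircle.map 1 = id := funext PlaneCircle.map_one
    simp [this]
  mul_mem' := by
    intro Φ Ψ hΦ hΨ
    have : PlaneCircle.map (Φ * Ψ) = PlaneCircle.map Φ ∘ PlaneCircle.map Ψ :=
      funext (PlaneCircle.map_mul Φ Ψ)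
    simp only [Set.mem_ofPred_eq] at hΦ hΨ ⊢
    rw [this, Set.image_comp, hΨ, hΦ]
  inv_mem' := by
    intro Φ hΦ
    have : PlaneCircle.map Φ⁻¹ ∘ PlaneCircle.map Φ = id := by
      funext C
      simp [← PlaneCircle.map_mul, PlaneCircle.map_one]
    simp only [Set.mem_ofPred_eq] at hΦ ⊢
    conv_lhs => rw [← hΦ]
    rw [← Set.image_comp, this, Set.image_id]

/-- The orientation-preserving similarities: those of the form `x ↦ μ A x + b` with `μ > 0` and
`A` orthogonal of determinant `1`. -/
noncomputable def orientationPreserving : Subgroup Similarity where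
  carrier := {Φ | ∃ (μ : ℝ) (A : Plane ≃ₗᵢ[ℝ] Plane) (b : Plane), 0 < μ ∧
    LinearMap.det (A.toLinearEquiv : Plane →ₗ[ℝ] Plane) = 1 ∧ ∀ x, Φ x = μ • A x + b}
  one_mem' := ⟨1, LinearIsometryEquiv.refl ℝ Plane, 0, one_pos,
    LinearMap.det_id, fun x => by simp⟩
  mul_mem' := by
    rintro Φ Ψ ⟨μ, A, b, hμ, hA, hΦ⟩ ⟨ν, B, c, hν, hB, hΨ⟩
    refine ⟨μ * ν, B.trans A, μ • A c + b, by positivity, ?_, fun x => ?_⟩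
    · have : ((B.trans A).toLinearEquiv : Plane →ₗ[ℝ] Plane) =
          (A.toLinearEquiv : Plane →ₗ[ℝ] Plane) ∘ₗ (B.toLinearEquiv : Plane →ₗ[ℝ] Plane) := rfl
      rw [this, LinearMap.det_comp, hA, hB, one_mul]
    · simp [hΦ, hΨ, smul_smul, add_assoc]
  inv_mem' := by
    rintro Φ ⟨μ, A, b, hμ, hA, hΦ⟩
    refine ⟨μ⁻¹, A.symm, -(μ⁻¹ • A.symm b), by positivity, ?_, fun x => ?_⟩
    · have h : ((A.symm).toLinearEquiv : Plane →ₗ[ℝ] Plane) ∘ₗ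
          (A.toLinearEquiv : Plane →ₗ[ℝ] Plane) = LinearMap.id := by
        ext1 x
        simp
      have h2 := congrArg LinearMap.det h
      rwa [LinearMap.det_comp, hA, mul_one, LinearMap.det_id] at h2
    · rw [DilationEquiv.inv_def, DilationEquiv.symm_apply_eq, hΦ]
      simp [smul_smul, hμ.ne']

/-- The orientation-preserving self-similarity group of a packing. -/
noncomputable def SymmPlus (P : Set PlaneCircle) : Subgroup Similarity :=
  Symm P ⊓ orientationPreserving

end Apollonian

namespace Apollonian

/-! A circle with a chosen side is a unit vector for a Lorentz form `ip` on ℝ⁴, and two circles with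
disjoint interiors that are tangent have inner product −1. Four mutually tangent circles form a
basis with Gram matrix 2I − J (J the all-ones matrix), and `reflect` yields the second circle
tangent to three of them. The packing is therefore the orbit of one quadruple under words in these
reflections (`generatedPacking_eq`). Along a reduced word, once a given circle has been replaced,
the inner products with it only become more negative (`Reduced.fixed_or_grow`). Hence distinct
circles of the orbit have inner product at most −1, any three mutually tangent ones lie in a common
reachable quadruple and generate the whole packing, and a similarity is a symmetry as soon as it
maps one such triple into the packing (`mem_symm_of_triple`).

The circles tangent to the x-axis are indexed by coprime pairs (m, n) up to sign
(`exists_eq_fordInt`, `fordInt_mem`): the curvature is (mα + n)², and tangency means determinant ±1.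
A similarity of ratio 1/l² fixing the axis acts linearly on the parameters s = mα + n and t = n/α,
with s ↦ ls. Symmetries fixing the axis thus correspond to integer matrices of determinant ε = ±1
with eigenvector (α, 1) and eigenvalue l > 0, and ε = 1 means orientation-preserving
(`HasAxialForm.exists_hasMatrix`, `HasMatrix.exists_mem_symm`).

If α is irrational, the axis is the only line of the packing, so every symmetry arises this way. The
eigenvector equation is an integral quadratic relation for α. If α is not quadratic, the relation is
trivial, the matrix is scalar, and the group is trivial. If α is quadratic, the matrices come from
solutions of x² − Dy² = 4ε: Pell's equation gives a nontrivial one, integrality of the trace keeps l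
away from 1, so the group is infinite cyclic, and the solutions for −4 are the orientation-reversing
symmetries. If α = p/q, the index (−q, p) has curvature zero and gives a second line; the symmetries
are those of the row of equal circles touching both lines. -/

/-! ### The Lorentz space of circles -/

/-- Coordinates `(b, b', u, v)` of a circle: `b` is the curvature, `b'` the co-curvature and
`(u, v)` the curvature times the centre. -/
abbrev Vec : Type := Fin 4 → ℝ

/-- The Lorentz form on the space of circles. -/
noncomputable def ip (w z : Vec) : ℝ :=
  w 2 * z 2 + w 3 * z 3 - (w 0 * z 1 + w 1 * z 0) / 2

theorem ip_comm (w z : Vec) : ip w z = ip z w := by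
  simp only [ip]; ring

theorem ip_add_right (w z y : Vec) : ip w (z + y) = ip w z + ip w y := by
  simp only [ip, Pi.add_apply]; ring

theorem ip_sub_right (w z y : Vec) : ip w (z - y) = ip w z - ip w y := by
  simp only [ip, Pi.sub_apply]; ring

theorem ip_smul_right (w z : Vec) (c : ℝ) : ip w (c • z) = c * ip w z := by
  simp only [ip, Pi.smul_apply, smul_eq_mul]; ring

theorem ip_add_left (w z y : Vec) : ip (w + z) y = ip w y + ip z y := by
  simp only [ip, Pi.add_apply]; ring

theorem ip_smul_left (w z : Vec) (c : ℝ) : ip (c • w) z = c * ip w z := by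
  simp only [ip, Pi.smul_apply, smul_eq_mul]; ring

/-! ### Descartes quadruples -/

/-- Four mutually tangent circles. -/
def IsDescartes (q : Fin 4 → Vec) : Prop :=
  ∀ i j, ip (q i) (q j) = if i = j then 1 else -1

/-- Replace the `i`-th circle of a Descartes quadruple by the other circle tangent to the
remaining three. -/
noncomputable def reflect (q : Fin 4 → Vec) (i : Fin 4) : Fin 4 → Vec :=
  Function.update q i ((2 : ℝ) • (q 0 + q 1 + q 2 + q 3) - (3 : ℝ) • q i)

theorem reflect_self (q : Fin 4 → Vec) (i : Fin 4) :
    reflect q i i = (2 : ℝ) • (q 0 + q 1 + q 2 + q 3) - (3 : ℝ) • q i := by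
  simp [reflect]

theorem reflect_of_ne (q : Fin 4 → Vec) {i j : Fin 4} (h : j ≠ i) : reflect q i j = q j := by
  simp [reflect, h]

theorem reflect_reflect (q : Fin 4 → Vec) (i : Fin 4) : reflect (reflect q i) i = q := by
  funext j
  by_cases h : j = i
  · subst h
    rw [reflect_self, reflect_self]
    fin_cases j <;> simp [reflect] <;> module
  · rw [reflect_of_ne _ h, reflect_of_ne _ h]

theorem ip_reflect_self (q : Fin 4 → Vec) (i : Fin 4) (w : Vec) :
    ip w (reflect q i i) =
      2 * (ip w (q 0) + ip w (q 1) + ip w (q 2) + ip w (q 3)) - 3 * ip w (q i) := by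
  simp only [reflect_self, ip_sub_right, ip_smul_right, ip_add_right]

theorem IsDescartes.self {q : Fin 4 → Vec} (h : IsDescartes q) (i : Fin 4) :
    ip (q i) (q i) = 1 := by simp [h i i]

theorem IsDescartes.ne {q : Fin 4 → Vec} (h : IsDescartes q) {i j : Fin 4} (hij : i ≠ j) :
    ip (q i) (q j) = -1 := by simp [h i j, hij]

theorem IsDescartes.sum_eq {q : Fin 4 → Vec} (h : IsDescartes q) (i : Fin 4) :
    ip (q i) (q 0) + ip (q i) (q 1) + ip (q i) (q 2) + ip (q i) (q 3) = -2 := by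
  fin_cases i <;> simp [h _ _] <;> norm_num

theorem IsDescartes.reflect {q : Fin 4 → Vec} (h : IsDescartes q) (k : Fin 4) :
    IsDescartes (reflect q k) := by
  have h1 : ∀ j, j ≠ k → ip (q j) (Apollonian.reflect q k k) = -1 := fun j hj => by
    rw [ip_reflect_self, h.sum_eq, h.ne hj]; norm_num
  have h2 : ip (q k) (Apollonian.reflect q k k) = -7 := by
    rw [ip_reflect_self, h.sum_eq, h.self]; norm_num
  intro i j
  by_cases hi : i = k <;> by_cases hj : j = k
  · subst hi hj
    rw [if_pos rfl, ip_reflect_self]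
    have hs : ∀ l, ip (Apollonian.reflect q j j) (q l) = if l = j then -7 else -1 := by
      intro l
      rw [ip_comm]
      split_ifs with hl
      · rw [hl, h2]
      · exact h1 l hl
    simp only [hs, if_pos]
    fin_cases j <;> simp <;> norm_num
  · subst hi
    rw [reflect_of_ne _ hj, ip_comm, h1 j hj, if_neg (Ne.symm hj)]
  · subst hj
    rw [reflect_of_ne _ hi, h1 i hi, if_neg hi]
  · rw [reflect_of_ne _ hi, reflect_of_ne _ hj, h i j]

/-- The expansion of a vector in a Descartes quadruple. -/
theorem IsDescartes.expand {q : Fin 4 → Vec} (h : IsDescartes q) (w : Vec) :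
    w = (1 / 2 : ℝ) • (ip w (q 0) • q 0 + ip w (q 1) • q 1 + ip w (q 2) • q 2 + ip w (q 3) • q 3)
      - ((ip w (q 0) + ip w (q 1) + ip w (q 2) + ip w (q 3)) / 4) •
        (q 0 + q 1 + q 2 + q 3) := by
  let M : Matrix (Fin 4) (Fin 4) ℝ := Matrix.of q
  -- `E` is the matrix of `ip`, and `G` = I/2 − J/4 is the inverse of the Gram matrix 2I − J.
  let E : Matrix (Fin 4) (Fin 4) ℝ := !![0, -1/2, 0, 0; -1/2, 0, 0, 0; 0, 0, 1, 0; 0, 0, 0, 1]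
  let G : Matrix (Fin 4) (Fin 4) ℝ :=
    !![1/4, -1/4, -1/4, -1/4; -1/4, 1/4, -1/4, -1/4; -1/4, -1/4, 1/4, -1/4; -1/4, -1/4, -1/4, 1/4]
  have hG : M * (E * M.transpose) = Matrix.of fun i j => if i = j then (1 : ℝ) else -1 := by
    ext i j
    rw [Matrix.of_apply, ← h i j]
    simp [M, E, Matrix.mul_apply, Matrix.vecMul, dotProduct, Fin.sum_univ_four, ip]
    ring
  have hG' : (Matrix.of fun i j : Fin 4 => if i = j then (1 : ℝ) else -1) * G = 1 := by
    ext i j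
    fin_cases i <;> fin_cases j <;> simp [G, Matrix.mul_apply, Fin.sum_univ_four] <;> norm_num
  have h1 : M * (E * M.transpose * G) = 1 := by
    rw [← Matrix.mul_assoc, hG, hG']
  -- A one-sided inverse of a square matrix is two-sided; this order of the factors expresses `w`
  -- through the rows of `M`.
  have h2 : (E * M.transpose * G) * M = 1 := mul_eq_one_comm.1 h1
  have h3 : Matrix.vecMul w ((E * M.transpose * G) * M) = w := by rw [h2, Matrix.vecMul_one]
  have h4 : ∀ j, Matrix.vecMul w (E * M.transpose) j = ip w (q j) := by
    intro j
    simp [Matrix.vecMul, dotProduct, M, E, Matrix.mul_apply, Fin.sum_univ_four, ip]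
    ring
  rw [← Matrix.vecMul_vecMul, ← Matrix.vecMul_vecMul] at h3
  conv_lhs => rw [← h3]
  funext i
  simp only [Matrix.vecMul, dotProduct, Fin.sum_univ_four] at h4 ⊢
  simp only [h4]
  simp [G, M]
  ring

/-- There are exactly two circles tangent to three mutually tangent ones. -/
theorem IsDescartes.eq_or_eq {q : Fin 4 → Vec} (h : IsDescartes q) (i : Fin 4) {w : Vec}
    (hw : ip w w = 1) (hi : ∀ j, j ≠ i → ip w (q j) = -1) :
    w = q i ∨ w = Apollonian.reflect q i i := by
  have key := h.expand w
  have hsum : ip w (q 0) + ip w (q 1) + ip w (q 2) + ip w (q 3) = ip w (q i) - 3 := by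
    fin_cases i <;> simp [hi _] <;> ring
  have hlin : ip w (q 0) • q 0 + ip w (q 1) • q 1 + ip w (q 2) • q 2 + ip w (q 3) • q 3 =
      (ip w (q i) + 1) • q i - (q 0 + q 1 + q 2 + q 3) := by
    fin_cases i <;> simp [hi _] <;> module
  rw [hsum, hlin] at key
  have hn := congrArg (ip w) key
  rw [hw] at hn
  simp only [ip_sub_right, ip_smul_right, ip_add_right] at hn
  rw [hsum] at hn
  -- The norm condition on `w` becomes a quadratic in its last unknown inner product. The root 1
  -- belongs to `q i`, and −7 is the inner product of `q i` with its reflection.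
  have : (ip w (q i) - 1) * (ip w (q i) + 7) = 0 := by linear_combination (-4) * hn
  rcases mul_eq_zero.1 this with h1 | h1
  · left
    have h1 : ip w (q i) = 1 := by linarith
    rw [h1] at key
    rw [key]; module
  · right
    have h1 : ip w (q i) = -7 := by linarith
    rw [h1] at key
    rw [key, reflect_self]; module

/-! ### Reachable quadruples -/

/-- `Reach q q'` means that `q'` arises from `q` by a sequence of reflections. -/
def Reach : (Fin 4 → Vec) → (Fin 4 → Vec) → Prop :=
  Relation.ReflTransGen fun q q' => ∃ k, q' = reflect q k

theorem Reach.symm {q q' : Fin 4 → Vec} (h : Reach q q') : Reach q' q := by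
  induction h with
  | refl => exact Relation.ReflTransGen.refl
  | tail _ h ih =>
    obtain ⟨k, rfl⟩ := h
    exact Relation.ReflTransGen.head ⟨k, (reflect_reflect _ _).symm⟩ ih

theorem Reach.trans {q q' q'' : Fin 4 → Vec} (h : Reach q q') (h' : Reach q' q'') :
    Reach q q'' :=
  Relation.ReflTransGen.trans h h'

theorem Reach.isDescartes {q q' : Fin 4 → Vec} (h : Reach q q') (hq : IsDescartes q) :
    IsDescartes q' := by
  induction h with
  | refl => exact hq
  | tail _ h ih => obtain ⟨k, rfl⟩ := h; exact ih.reflect k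

/-- The circles of the packing generated by a Descartes quadruple. -/
def orbit (q : Fin 4 → Vec) : Set Vec :=
  {w | ∃ q', Reach q q' ∧ ∃ i, w = q' i}

theorem Reach.orbit_eq {q q' : Fin 4 → Vec} (h : Reach q q') : orbit q' = orbit q := by
  ext w
  exact ⟨fun ⟨r, hr, hi⟩ => ⟨r, h.trans hr, hi⟩, fun ⟨r, hr, hi⟩ => ⟨r, h.symm.trans hr, hi⟩⟩

theorem mem_orbit_self (q : Fin 4 → Vec) (i : Fin 4) : q i ∈ orbit q :=
  ⟨q, Relation.ReflTransGen.refl, i, rfl⟩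

theorem Reach.mem_orbit {q q' : Fin 4 → Vec} (h : Reach q q') (i : Fin 4) : q' i ∈ orbit q :=
  ⟨q', h, i, rfl⟩

/-- `Reduced q q' k` means that `q'` arises from `q` by a nonempty sequence of reflections without
repetitions of consecutive indices, the last one having index `k`. -/
inductive Reduced (q : Fin 4 → Vec) : (Fin 4 → Vec) → Fin 4 → Prop
  | first (k : Fin 4) : Reduced q (reflect q k) k
  | step {q' : Fin 4 → Vec} {k j : Fin 4} : Reduced q q' k → j ≠ k → Reduced q (reflect q' j) j

theorem Reduced.reach {q q' : Fin 4 → Vec} {k : Fin 4} (h : Reduced q q' k) : Reach q q' := by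
  induction h with
  | first k => exact Relation.ReflTransGen.single ⟨k, rfl⟩
  | step _ _ ih => exact ih.tail ⟨_, rfl⟩

theorem Reach.eq_or_reduced {q q' : Fin 4 → Vec} (h : Reach q q') :
    q' = q ∨ ∃ k, Reduced q q' k := by
  induction h with
  | refl => exact Or.inl rfl
  | tail _ h ih =>
    obtain ⟨j, rfl⟩ := h
    rcases ih with rfl | ⟨k, hk⟩
    · exact Or.inr ⟨j, .first j⟩
    · by_cases hjk : j = k
      · subst hjk
        cases hk with
        | first => exact Or.inl (reflect_reflect _ _)
        | step h' _ => exact Or.inr ⟨_, by rwa [reflect_reflect]⟩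
      · exact Or.inr ⟨j, hk.step hjk⟩

/-- A circle survives unchanged until its index is reflected, so cutting the word just after the
last reflection at its index exhibits it as the newest circle of a reduced word. -/
theorem mem_orbit_cases {q : Fin 4 → Vec} {w : Vec} (h : w ∈ orbit q) :
    (∃ i, w = q i) ∨ ∃ q' k, Reduced q q' k ∧ w = q' k := by
  obtain ⟨q', hq', i, rfl⟩ := h
  rcases hq'.eq_or_reduced with rfl | ⟨k, hk⟩
  · exact Or.inl ⟨i, rfl⟩
  · clear hq'
    induction hk with
    | first k =>
      by_cases hi : i = k
      · exact Or.inr ⟨_, k, .first k, by rw [hi]⟩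
      · exact Or.inl ⟨i, reflect_of_ne _ hi⟩
    | @step r k j hr hjk ih =>
      by_cases hi : i = j
      · exact Or.inr ⟨_, j, hr.step hjk, by rw [hi]⟩
      · rw [reflect_of_ne _ hi]
        exact ih

/-! ### Growth of inner products along reduced words -/

/-- The inner products with a fixed circle increase along a reduced sequence of reflections. -/
def Grow (g : Fin 4 → ℝ) (k : Fin 4) : Prop :=
  7 ≤ g k ∧ ∀ j, 1 ≤ g j ∧ g j ≤ g k

/-- The replaced entry is not the last one, whose value is maximal. With the other two entries at
least 1, the new value is at least 2 g k + 4 − g j ≥ g k. -/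
theorem Grow.update {g g' : Fin 4 → ℝ} {k j : Fin 4} (h : Grow g k) (hj : j ≠ k)
    (hg : g' j = 2 * (g 0 + g 1 + g 2 + g 3) - 3 * g j) (hg' : ∀ l, l ≠ j → g' l = g l) :
    Grow g' j := by
  obtain ⟨h7, h⟩ := h
  have hs : g j + g k + 2 ≤ g 0 + g 1 + g 2 + g 3 := by
    have h0 := (h 0).1
    have h1 := (h 1).1
    have h2 := (h 2).1
    have h3 := (h 3).1
    fin_cases j <;> fin_cases k <;> simp at hj ⊢ <;> linarith
  have hkj : g k ≤ g' j := by
    rw [hg]; linarith [(h j).2]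
  refine ⟨h7.trans hkj, fun l => ?_⟩
  by_cases hl : l = j
  · subst hl
    exact ⟨by linarith, le_rfl⟩
  · rw [hg' l hl]
    exact ⟨(h l).1, (h l).2.trans hkj⟩

/-- Until the index `i` is used, the circle `q i` stays in the quadruple. Its first use makes the
negated inner products 7, 1, 1, 1, and from then on `Grow.update` applies. The predicate `I` is an
arbitrary invariant carried along the part of the word that fixes `q i`. -/
theorem Reduced.fixed_or_grow {q q' : Fin 4 → Vec} {k : Fin 4} (h : Reduced q q' k)
    (hq : IsDescartes q) (i : Fin 4) (I : (Fin 4 → Vec) → Prop) (h0 : I q)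
    (hI : ∀ r j, IsDescartes r → j ≠ i → r i = q i → I r → I (reflect r j)) :
    (q' i = q i ∧ k ≠ i ∧ I q') ∨ Grow (fun j => -ip (q i) (q' j)) k := by
  have start : ∀ r, IsDescartes r → r i = q i → Grow (fun j => -ip (q i) (reflect r i j)) i := by
    intro r hr hi
    have h7 : ip (q i) (reflect r i i) = -7 := by
      rw [ip_reflect_self, ← hi, hr.sum_eq, hr.self]; norm_num
    refine ⟨by simp [h7], fun j => ?_⟩
    by_cases hj : j = i
    · subst hj; simp [h7]
    · simp only [h7, reflect_of_ne _ hj]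
      rw [← hi, hr.ne (Ne.symm hj)]
      norm_num
  induction h with
  | first k =>
    by_cases hk : k = i
    · subst hk
      exact Or.inr (start q hq rfl)
    · exact Or.inl ⟨reflect_of_ne _ (Ne.symm hk), hk, hI q k hq hk rfl h0⟩
  | @step r k j hr hjk ih =>
    have hr' := hr.reach.isDescartes hq
    rcases ih with ⟨h1, -, h3⟩ | h1
    · by_cases hj : j = i
      · subst hj
        exact Or.inr (start r hr' h1)
      · exact Or.inl ⟨by rw [reflect_of_ne _ (Ne.symm hj), h1], hj, hI r j hr' hj h1 h3⟩
    · right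
      refine h1.update hjk ?_ fun l hl => ?_
      · rw [ip_reflect_self]; ring
      · rw [reflect_of_ne _ hl]

/-- This is the key to disjointness: no two different circles of the orbit intersect transversally
or are nested. -/
theorem ip_orbit_of_base {q : Fin 4 → Vec} (hq : IsDescartes q) (i : Fin 4) {w : Vec}
    (hw : w ∈ orbit q) : w = q i ∨ ip (q i) w ≤ -1 := by
  rcases mem_orbit_cases hw with ⟨j, rfl⟩ | ⟨q', k, hk, rfl⟩
  · by_cases hj : j = i
    · exact Or.inl (by rw [hj])
    · exact Or.inr (hq.ne (Ne.symm hj)).le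
  · right
    rcases hk.fixed_or_grow hq i (fun _ => True) trivial (fun _ _ _ _ _ _ => trivial) with
      ⟨h1, h2, -⟩ | h
    · rw [← h1, (hk.reach.isDescartes hq).ne (Ne.symm h2)]
    · linarith [(h.2 k).1]

theorem ip_orbit {q : Fin 4 → Vec} (hq : IsDescartes q) {w z : Vec} (hw : w ∈ orbit q)
    (hz : z ∈ orbit q) : z = w ∨ ip w z ≤ -1 := by
  obtain ⟨q', hq', i, rfl⟩ := hw
  rw [← hq'.orbit_eq] at hz
  exact ip_orbit_of_base (hq'.isDescartes hq) i hz

theorem ip_self_of_mem_orbit {q : Fin 4 → Vec} (hq : IsDescartes q) {w : Vec}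
    (hw : w ∈ orbit q) : ip w w = 1 := by
  obtain ⟨q', hq', i, rfl⟩ := hw
  exact (hq'.isDescartes hq).self i

/-- A circle of the packing that is tangent to one of the generating circles occurs in a
quadruple reached by reflections fixing that circle. -/
theorem exists_of_ip_eq {q : Fin 4 → Vec} (hq : IsDescartes q) {w : Vec} (hw : w ∈ orbit q) :
    ∃ q', Reach q q' ∧ (∃ l, w = q' l) ∧ ∀ i, ip (q i) w = -1 →
      q' i = q i ∧ ∀ I : (Fin 4 → Vec) → Prop, I q →
        (∀ r j, IsDescartes r → j ≠ i → r i = q i → I r → I (reflect r j)) → I q' := by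
  rcases mem_orbit_cases hw with ⟨l, rfl⟩ | ⟨q', k, hk, rfl⟩
  · exact ⟨q, Relation.ReflTransGen.refl, ⟨l, rfl⟩, fun i _ => ⟨rfl, fun _ h _ => h⟩⟩
  · refine ⟨q', hk.reach, ⟨k, rfl⟩, fun i hi => ⟨?_, fun I h0 hI => ?_⟩⟩
    · rcases hk.fixed_or_grow hq i (fun _ => True) trivial (fun _ _ _ _ _ _ => trivial) with
        ⟨h1, -, -⟩ | h
      · exact h1
      · have := h.1
        simp only [hi] at this
        norm_num at this
    · rcases hk.fixed_or_grow hq i I h0 hI with ⟨-, -, h1⟩ | h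
      · exact h1
      · have := h.1
        simp only [hi] at this
        norm_num at this

/-- Three mutually tangent circles of the packing belong to a reachable quadruple. -/
theorem exists_reach_of_triple {q : Fin 4 → Vec} (hq : IsDescartes q) {a b c : Vec}
    (ha : a ∈ orbit q) (hb : b ∈ orbit q) (hc : c ∈ orbit q) (hab : ip a b = -1)
    (hbc : ip b c = -1) (hac : ip a c = -1) :
    ∃ q', Reach q q' ∧ ∃ i j k, i ≠ j ∧ j ≠ k ∧ i ≠ k ∧ a = q' i ∧ b = q' j ∧ c = q' k := by
  have ha1 := ip_self_of_mem_orbit hq ha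
  have hb1 := ip_self_of_mem_orbit hq hb
  obtain ⟨q₁, h₁, i, rfl⟩ := ha
  have hq₁ := h₁.isDescartes hq
  rw [← h₁.orbit_eq] at hb hc
  obtain ⟨q₂, h₂, ⟨j, rfl⟩, hfix⟩ := exists_of_ip_eq hq₁ hb
  have hi := (hfix i hab).1
  have hq₂ := h₂.isDescartes hq₁
  rw [← h₂.orbit_eq] at hc
  rw [← hi] at hac hab ha1 ⊢
  -- In `exists_of_ip_eq` the new quadruple is chosen before the index, so a single `q₃` retains
  -- both earlier circles.
  obtain ⟨q₃, h₃, ⟨k, rfl⟩, hfix'⟩ := exists_of_ip_eq hq₂ hc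
  have hi' := (hfix' i hac).1
  have hj' := (hfix' j hbc).1
  refine ⟨q₃, (h₁.trans h₂).trans h₃, i, j, k, ?_, ?_, ?_, hi'.symm, hj'.symm, rfl⟩
  · rintro rfl
    norm_num [ha1] at hab
  · rintro rfl
    rw [hj'] at hbc
    norm_num [hb1] at hbc
  · rintro rfl
    rw [hi'] at hac
    norm_num [ha1] at hac

theorem exists_fourth {i j k : Fin 4} (hij : i ≠ j) (hjk : j ≠ k) (hik : i ≠ k) :
    ∃ l, ∀ m, m ≠ l ↔ m = i ∨ m = j ∨ m = k := by
  revert i j k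
  decide

/-- The packing contains all circles tangent to three mutually tangent ones. -/
theorem orbit_closed {q : Fin 4 → Vec} (hq : IsDescartes q) {a b c d : Vec}
    (ha : a ∈ orbit q) (hb : b ∈ orbit q) (hc : c ∈ orbit q) (hab : ip a b = -1)
    (hbc : ip b c = -1) (hac : ip a c = -1) (hd : ip d d = 1) (hda : ip d a = -1)
    (hdb : ip d b = -1) (hdc : ip d c = -1) : d ∈ orbit q := by
  obtain ⟨q', h, i, j, k, hij, hjk, hik, rfl, rfl, rfl⟩ :=
    exists_reach_of_triple hq ha hb hc hab hbc hac
  obtain ⟨l, hl⟩ := exists_fourth hij hjk hik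
  rcases (h.isDescartes hq).eq_or_eq l hd (fun m hm => by
    rcases (hl m).1 hm with rfl | rfl | rfl <;> assumption) with rfl | rfl
  · exact h.mem_orbit l
  · exact Reach.mem_orbit (h.tail ⟨l, rfl⟩) l

/-! ### The time orientation -/

/-- A nonzero vector in the closed future cone. -/
def Future (w : Vec) : Prop :=
  0 ≤ w 0 ∧ 0 ≤ w 1 ∧ ip w w ≤ 0 ∧ w ≠ 0

/-- The reversed Cauchy–Schwarz inequality on the future cone. -/
theorem Future.ip_nonpos {w z : Vec} (hw : Future w) (hz : 0 ≤ z 0 ∧ 0 ≤ z 1 ∧ ip z z ≤ 0) :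
    ip w z ≤ 0 := by
  obtain ⟨h0, h1, h2, -⟩ := hw
  obtain ⟨g0, g1, g2⟩ := hz
  simp only [ip] at h2 g2 ⊢
  have hA : w 2 ^ 2 + w 3 ^ 2 ≤ w 0 * w 1 := by linarith
  have hB : z 2 ^ 2 + z 3 ^ 2 ≤ z 0 * z 1 := by linarith
  have hAB : (w 2 * z 2 + w 3 * z 3) ^ 2 ≤ ((w 0 * z 1 + w 1 * z 0) / 2) ^ 2 := by
    have h3 : (w 2 * z 2 + w 3 * z 3) ^ 2 ≤ (w 2 ^ 2 + w 3 ^ 2) * (z 2 ^ 2 + z 3 ^ 2) := by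
      nlinarith [sq_nonneg (w 2 * z 3 - w 3 * z 2)]
    have h4 : (w 2 ^ 2 + w 3 ^ 2) * (z 2 ^ 2 + z 3 ^ 2) ≤ (w 0 * w 1) * (z 0 * z 1) :=
      mul_le_mul hA hB (by positivity) (by positivity)
    nlinarith [sq_nonneg (w 0 * z 1 - w 1 * z 0)]
  linarith [le_of_abs_le (abs_le_of_sq_le_sq hAB (by positivity))]

theorem Future.of_ip_neg {w z : Vec} (hw : Future w) (hz : ip z z ≤ 0) (h : ip w z < 0) :
    Future z := by
  have hz0 : z ≠ 0 := by
    rintro rfl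
    simp [ip] at h
  have hz' : z 2 ^ 2 + z 3 ^ 2 ≤ z 0 * z 1 := by
    simp only [ip] at hz; linarith
  have hp : 0 ≤ z 0 * z 1 := le_trans (by positivity) hz'
  rcases mul_nonneg_iff.1 hp with ⟨h0, h1⟩ | ⟨h0, h1⟩
  · exact ⟨h0, h1, hz, hz0⟩
  · have := hw.ip_nonpos (z := (-1 : ℝ) • z)
      ⟨by simpa using h0, by simpa using h1, by
        rw [ip_smul_left, ip_smul_right]; linarith⟩
    rw [ip_smul_right] at this
    linarith

/-- The sum of a Descartes quadruple has norm −8; it is a timelike vector against which all circles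
of the orbit lie on the same side. -/
theorem ip_sum_lt {q : Fin 4 → Vec} (hq : IsDescartes q) {w : Vec} (hw : w ∈ orbit q) :
    ip (q 0 + q 1 + q 2 + q 3) w < 0 := by
  by_cases h : ∃ i, w = q i
  · obtain ⟨i, rfl⟩ := h
    rw [ip_comm]
    simp only [ip_add_right]
    rw [hq.sum_eq]; norm_num
  · push Not at h
    have h' : ∀ i, ip (q i) w ≤ -1 := fun i =>
      (ip_orbit_of_base hq i hw).resolve_left (h i)
    simp only [ip_add_left]
    linarith [h' 0, h' 1, h' 2, h' 3]

/-- The norm of `w + z` is 2 + 2 `ip w z` ≤ 0, and pairing with the timelike sum of the quadruple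
decides which half of the cone it lies in. -/
theorem future_add_of_mem_orbit {q : Fin 4 → Vec} (hq : IsDescartes q)
    (hZ : Future (q 0 + q 1 + q 2 + q 3)) {w z : Vec} (hw : w ∈ orbit q) (hz : z ∈ orbit q)
    (hne : z ≠ w) : Future (w + z) := by
  refine hZ.of_ip_neg ?_ ?_
  · simp only [ip_add_left, ip_add_right]
    rw [ip_self_of_mem_orbit hq hw, ip_self_of_mem_orbit hq hz, ip_comm z w]
    linarith [(ip_orbit hq hw hz).resolve_left hne]
  · rw [ip_add_right]
    linarith [ip_sum_lt hq hw, ip_sum_lt hq hz]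

theorem Reach.future {q q' : Fin 4 → Vec} (h : Reach q q') (hq : IsDescartes q)
    (hZ : Future (q 0 + q 1 + q 2 + q 3)) : Future (q' 0 + q' 1 + q' 2 + q' 3) := by
  refine hZ.of_ip_neg ?_ ?_
  · have hq' := h.isDescartes hq
    have := hq'.sum_eq
    simp only [ip_add_left]
    simp only [ip_add_right]
    linarith [this 0, this 1, this 2, this 3]
  · have := fun i => ip_sum_lt hq (h.mem_orbit i)
    simp only [ip_add_right]
    linarith [this 0, this 1, this 2, this 3]

/-! ### Circles in the plane as vectors of the Lorentz space -/

/-- The quadratic function whose zero set is the circle with the given coordinates. -/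
noncomputable def powerAt (w : Vec) (x : Plane) : ℝ :=
  w 0 * (x 0 ^ 2 + x 1 ^ 2) - 2 * (w 2 * x 0 + w 3 * x 1) + w 1

/-- `w` is the vector of coordinates of the circle `C`. -/
structure Represents (w : Vec) (C : PlaneCircle) : Prop where
  ip_self : ip w w = 1
  curve_eq : C.curve = {x | powerAt w x = 0}
  interior_eq : C.interior = {x | powerAt w x < 0}

theorem Represents.mem_curve {w : Vec} {C : PlaneCircle} (h : Represents w C) (x : Plane) :
    x ∈ C.curve ↔ powerAt w x = 0 := by rw [h.curve_eq]; rfl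

theorem Represents.mem_interior {w : Vec} {C : PlaneCircle} (h : Represents w C) (x : Plane) :
    x ∈ C.interior ↔ powerAt w x < 0 := by rw [h.interior_eq]; rfl

theorem dist_sq (x c : Plane) : dist x c ^ 2 = (x 0 - c 0) ^ 2 + (x 1 - c 1) ^ 2 := by
  rw [EuclideanSpace.dist_eq, Real.sq_sqrt (by positivity), Fin.sum_univ_two, Real.dist_eq,
    Real.dist_eq, sq_abs, sq_abs]

theorem inner_eq (n x : Plane) : inner ℝ n x = n 0 * x 0 + n 1 * x 1 := by
  simp [PiLp.inner_apply, Fin.sum_univ_two]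
  ring

theorem norm_eq_one_iff (n : Plane) : ‖n‖ = 1 ↔ n 0 ^ 2 + n 1 ^ 2 = 1 := by
  rw [EuclideanSpace.norm_eq, Real.sqrt_eq_one, Fin.sum_univ_two, Real.norm_eq_abs,
    Real.norm_eq_abs, sq_abs, sq_abs]

theorem plane_ext {x y : Plane} (h0 : x 0 = y 0) (h1 : x 1 = y 1) : x = y := by
  ext i
  fin_cases i
  · exact h0
  · exact h1

/-- The coordinates of the circle with centre `c` and signed radius `r`. -/
noncomputable def roundVec (c : Plane) (r : ℝ) : Vec :=
  ![1 / r, (c 0 ^ 2 + c 1 ^ 2 - r ^ 2) / r, c 0 / r, c 1 / r]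

/-- The coordinates of the line `⟪n, x⟫ = t` with interior `⟪n, x⟫ < t`. -/
def lineVec (n : Plane) (t : ℝ) : Vec := ![0, -2 * t, -n 0, -n 1]

theorem ip_roundVec (c : Plane) {r : ℝ} (hr : r ≠ 0) : ip (roundVec c r) (roundVec c r) = 1 := by
  simp [ip, roundVec]
  field_simp
  ring

theorem ip_lineVec {n : Plane} (t : ℝ) (hn : ‖n‖ = 1) : ip (lineVec n t) (lineVec n t) = 1 := by
  rw [norm_eq_one_iff] at hn
  simp [ip, lineVec]
  linarith

theorem powerAt_roundVec (c : Plane) {r : ℝ} (hr : r ≠ 0) (x : Plane) :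
    powerAt (roundVec c r) x = (dist x c ^ 2 - r ^ 2) / r := by
  rw [dist_sq]
  simp [powerAt, roundVec]
  field_simp
  ring

theorem powerAt_lineVec (n : Plane) (t : ℝ) (x : Plane) :
    powerAt (lineVec n t) x = 2 * (inner ℝ n x - t) := by
  rw [inner_eq]
  simp [powerAt, lineVec]
  ring

theorem sphere_eq {c : Plane} {r s : ℝ} (hr : r ≠ 0) (hs : s = |r|) :
    Metric.sphere c s = {x | powerAt (roundVec c r) x = 0} := by
  ext x
  rw [Metric.mem_sphere, Set.mem_ofPred_eq, powerAt_roundVec c hr, div_eq_zero_iff,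
    or_iff_left hr, sub_eq_zero, sq_eq_sq_iff_abs_eq_abs, abs_of_nonneg dist_nonneg, hs]

theorem ball_eq {c : Plane} {r : ℝ} (hr : 0 < r) :
    Metric.ball c r = {x | powerAt (roundVec c r) x < 0} := by
  ext x
  rw [Metric.mem_ball, Set.mem_ofPred_eq, powerAt_roundVec c hr.ne', div_neg_iff]
  constructor
  · intro h
    exact Or.inr ⟨by nlinarith [dist_nonneg (x := x) (y := c)], hr⟩
  · rintro (⟨-, h⟩ | ⟨h, -⟩)
    · linarith
    · exact lt_of_pow_lt_pow_left₀ 2 hr.le (by linarith)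

theorem compl_closedBall_eq {c : Plane} {r : ℝ} (hr : 0 < r) :
    (Metric.closedBall c r)ᶜ = {x | powerAt (roundVec c (-r)) x < 0} := by
  ext x
  rw [Set.mem_compl_iff, Metric.mem_closedBall, not_le, Set.mem_ofPred_eq,
    powerAt_roundVec c (neg_ne_zero.2 hr.ne'), div_neg_iff]
  constructor
  · intro h
    exact Or.inl ⟨by nlinarith [dist_nonneg (x := x) (y := c)], by linarith⟩
  · rintro (⟨h, -⟩ | ⟨-, h⟩)
    · exact lt_of_pow_lt_pow_left₀ 2 dist_nonneg (by linarith [neg_sq r])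
    · linarith

theorem represents_disc (c : Plane) (r : ℝ) (hr : 0 < r) :
    Represents (roundVec c r) (disc c r hr) :=
  ⟨ip_roundVec c hr.ne', sphere_eq hr.ne' (abs_of_pos hr).symm, ball_eq hr⟩

theorem line_curve_eq (n : Plane) (t : ℝ) :
    {x | inner ℝ n x = t} = {x | powerAt (lineVec n t) x = 0} := by
  ext x
  rw [Set.mem_ofPred_eq, Set.mem_ofPred_eq, powerAt_lineVec]
  constructor <;> intro h <;> linarith

theorem line_interior_eq (n : Plane) (t : ℝ) :
    {x | inner ℝ n x < t} = {x | powerAt (lineVec n t) x < 0} := by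
  ext x
  rw [Set.mem_ofPred_eq, Set.mem_ofPred_eq, powerAt_lineVec]
  constructor <;> intro h <;> linarith

theorem represents_line (n : Plane) (t : ℝ) (hn : ‖n‖ = 1) :
    Represents (lineVec n t) (line n t hn) :=
  ⟨ip_lineVec t hn, line_curve_eq n t, line_interior_eq n t⟩

theorem exists_represents (C : PlaneCircle) : ∃ w, Represents w C := by
  rcases C.isCircle with ⟨c, r, hr, hs, hu | hu⟩ | ⟨n, t, hn, hs, hu⟩
  · exact ⟨roundVec c r, ip_roundVec c hr.ne', by rw [hs, sphere_eq hr.ne' (abs_of_pos hr).symm],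
      by rw [hu, ball_eq hr]⟩
  · exact ⟨roundVec c (-r), ip_roundVec c (neg_ne_zero.2 hr.ne'),
      by rw [hs, sphere_eq (neg_ne_zero.2 hr.ne') (by rw [abs_neg, abs_of_pos hr])],
      by rw [hu, compl_closedBall_eq hr]⟩
  · exact ⟨lineVec n t, ip_lineVec t hn, by rw [hs, line_curve_eq], by rw [hu, line_interior_eq]⟩

theorem eq_lineVec {w : Vec} (h0 : w 0 = 0) :
    w = lineVec !₂[-w 2, -w 3] (-w 1 / 2) := by
  funext i
  fin_cases i <;> simp [lineVec, h0]
  ring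

theorem norm_lineVec {w : Vec} (hw : ip w w = 1) (h0 : w 0 = 0) :
    ‖(!₂[-w 2, -w 3] : Plane)‖ = 1 := by
  rw [norm_eq_one_iff]
  simp [ip, h0] at hw ⊢
  linarith

theorem eq_roundVec {w : Vec} (hw : ip w w = 1) (h0 : w 0 ≠ 0) :
    w = roundVec !₂[w 2 / w 0, w 3 / w 0] (1 / w 0) := by
  have h1 : w 1 = (w 2 ^ 2 + w 3 ^ 2 - 1) / w 0 := by
    simp only [ip] at hw
    field_simp
    linarith
  funext i
  fin_cases i <;> simp [roundVec] <;> field_simp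
  rw [h1]
  field_simp

theorem exists_circle {w : Vec} (hw : ip w w = 1) : ∃ C : PlaneCircle, Represents w C := by
  by_cases h0 : w 0 = 0
  · rw [eq_lineVec h0]
    exact ⟨_, represents_line _ _ (norm_lineVec hw h0)⟩
  · rw [eq_roundVec hw h0]
    rcases lt_or_gt_of_ne h0 with h | h
    · have hr : 0 < -(1 / w 0) := by
        rw [neg_pos]; exact one_div_neg.2 h
      refine ⟨⟨Metric.sphere !₂[w 2 / w 0, w 3 / w 0] (-(1 / w 0)),
        (Metric.closedBall !₂[w 2 / w 0, w 3 / w 0] (-(1 / w 0)))ᶜ,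
        Or.inl ⟨_, _, hr, rfl, Or.inr rfl⟩⟩, ip_roundVec _ (by positivity), ?_, ?_⟩
      · exact sphere_eq (by positivity) (by rw [← abs_neg, abs_of_pos hr])
      · convert compl_closedBall_eq hr using 4
        rw [neg_neg]
    · exact ⟨_, represents_disc _ _ (one_div_pos.2 h)⟩

theorem Represents.circle_eq {w : Vec} {C D : PlaneCircle} (hC : Represents w C)
    (hD : Represents w D) : C = D := by
  ext x
  · rw [hC.mem_curve, hD.mem_curve]
  · rw [hC.mem_interior, hD.mem_interior]

/-- The curve determines the vector up to a scalar, the norm reduces the scalar to ±1, and the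
interior fixes the sign. -/
theorem Represents.vec_eq {w z : Vec} {C : PlaneCircle} (hw : Represents w C)
    (hz : Represents z C) : w = z := by
  have hc : ∀ x y, w 0 * (x ^ 2 + y ^ 2) - 2 * (w 2 * x + w 3 * y) + w 1 = 0 →
      z 0 * (x ^ 2 + y ^ 2) - 2 * (z 2 * x + z 3 * y) + z 1 = 0 := by
    intro x y h
    have := (hz.mem_curve !₂[x, y]).1 ((hw.mem_curve _).2 (by simpa [powerAt] using h))
    simpa [powerAt] using this
  have hi : ∀ x y, w 0 * (x ^ 2 + y ^ 2) - 2 * (w 2 * x + w 3 * y) + w 1 < 0 →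
      z 0 * (x ^ 2 + y ^ 2) - 2 * (z 2 * x + z 3 * y) + z 1 < 0 := by
    intro x y h
    have := (hz.mem_interior !₂[x, y]).1 ((hw.mem_interior _).2 (by simpa [powerAt] using h))
    simpa [powerAt] using this
  have hw1 := hw.ip_self
  have hz1 := hz.ip_self
  simp only [ip] at hw1 hz1
  obtain ⟨c, hcw⟩ : ∃ c : ℝ, ∀ i, z i = c * w i := by
    by_cases h0 : w 0 = 0
    · have hn : w 2 ^ 2 + w 3 ^ 2 = 1 := by rw [h0] at hw1; linarith
      set t := w 1 / 2 with ht
      -- Points of the line: the foot of the perpendicular from the origin, moved by `k` along the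
      -- line. The values 0, 1, −1 suffice.
      have a : ∀ k, z 0 * ((t * w 2 - k * w 3) ^ 2 + (t * w 3 + k * w 2) ^ 2)
          - 2 * (z 2 * (t * w 2 - k * w 3) + z 3 * (t * w 3 + k * w 2)) + z 1 = 0 := by
        intro k
        apply hc
        rw [h0, show w 1 = 2 * t by rw [ht]; ring]
        linear_combination (-2 * t) * hn
      have a0 := a 0
      have a1 := a 1
      have a2 := a (-1)
      have b0 : z 0 = 0 := by
        linear_combination (a1 + a2) / 2 - a0 - z 0 * hn
      have b1 : z 2 * w 3 = z 3 * w 2 := by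
        linear_combination (a1 - a2) / 4
      refine ⟨z 2 * w 2 + z 3 * w 3, fun i => ?_⟩
      have b2 : z 2 = (z 2 * w 2 + z 3 * w 3) * w 2 := by
        linear_combination (-z 2) * hn + w 3 * b1
      have b3 : z 3 = (z 2 * w 2 + z 3 * w 3) * w 3 := by
        linear_combination (-z 3) * hn - w 2 * b1
      have b4 : z 1 = (z 2 * w 2 + z 3 * w 3) * w 1 := by
        rw [b0] at a0
        rw [show w 1 = 2 * t by rw [ht]; ring]
        linear_combination a0
      fin_cases i
      · simp [b0, h0]
      · exact b4
      · exact b2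
      · exact b3
    · have a : ∀ k l : ℝ, k ^ 2 + l ^ 2 = 1 →
          z 0 * (((w 2 + k) / w 0) ^ 2 + ((w 3 + l) / w 0) ^ 2)
          - 2 * (z 2 * ((w 2 + k) / w 0) + z 3 * ((w 3 + l) / w 0)) + z 1 = 0 := by
        intro k l hkl
        apply hc
        field_simp
        linear_combination hkl - hw1
      have a1 := a 1 0 (by norm_num)
      have a2 := a (-1) 0 (by norm_num)
      have a3 := a 0 1 (by norm_num)
      have a4 := a 0 (-1) (by norm_num)
      field_simp at a1 a2 a3 a4
      refine ⟨z 0 / w 0, fun i => ?_⟩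
      have b2 : z 2 * w 0 = z 0 * w 2 := by
        linear_combination (a2 - a1) / 4
      have b3 : z 3 * w 0 = z 0 * w 3 := by
        linear_combination (a4 - a3) / 4
      have b1 : z 1 * w 0 = z 0 * w 1 := by
        apply mul_left_cancel₀ h0
        linear_combination (a1 + a2) / 2 + 2 * w 2 * b2 + 2 * w 3 * b3 + z 0 * hw1
      rw [div_mul_eq_mul_div, eq_div_iff h0]
      fin_cases i
      · rfl
      · exact b1
      · exact b2
      · exact b3
  have hc2 : (c - 1) * (c + 1) = 0 := by
    rw [hcw 0, hcw 1, hcw 2, hcw 3] at hz1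
    linear_combination hz1 - c ^ 2 * hw1
  rcases mul_eq_zero.1 hc2 with h | h
  · funext i
    rw [hcw i, show c = 1 by linarith, one_mul]
  · exfalso
    have hcm : c = -1 := by linarith
    -- The interior is nonempty. The witness is a point beyond the line, the centre, or for negative
    -- curvature a point at twice the radius from the centre.
    have hex : ∃ x y, w 0 * (x ^ 2 + y ^ 2) - 2 * (w 2 * x + w 3 * y) + w 1 < 0 := by
      by_cases h0 : w 0 = 0
      · have hn : w 2 ^ 2 + w 3 ^ 2 = 1 := by rw [h0] at hw1; linarith
        refine ⟨(w 1 / 2 + 1) * w 2, (w 1 / 2 + 1) * w 3, ?_⟩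
        have : w 0 * (((w 1 / 2 + 1) * w 2) ^ 2 + ((w 1 / 2 + 1) * w 3) ^ 2) -
            2 * (w 2 * ((w 1 / 2 + 1) * w 2) + w 3 * ((w 1 / 2 + 1) * w 3)) + w 1 = -2 := by
          rw [h0]
          linear_combination (-2 * (w 1 / 2 + 1)) * hn
        rw [this]
        norm_num
      · rcases lt_or_gt_of_ne h0 with h' | h'
        · refine ⟨(w 2 + 2) / w 0, w 3 / w 0, ?_⟩
          have : w 0 * (((w 2 + 2) / w 0) ^ 2 + (w 3 / w 0) ^ 2) -
              2 * (w 2 * ((w 2 + 2) / w 0) + w 3 * (w 3 / w 0)) + w 1 = 3 / w 0 := by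
            field_simp
            linear_combination -hw1
          rw [this]
          exact div_neg_of_pos_of_neg (by norm_num) h'
        · refine ⟨w 2 / w 0, w 3 / w 0, ?_⟩
          have : w 0 * ((w 2 / w 0) ^ 2 + (w 3 / w 0) ^ 2) -
              2 * (w 2 * (w 2 / w 0) + w 3 * (w 3 / w 0)) + w 1 = -1 / w 0 := by
            field_simp
            linear_combination -hw1
          rw [this]
          exact div_neg_of_neg_of_pos (by norm_num) h'
    obtain ⟨x, y, hxy⟩ := hex
    have := hi x y hxy
    rw [hcw 0, hcw 1, hcw 2, hcw 3, hcm] at this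
    linarith

/-- The coordinates of a circle. -/
noncomputable def PlaneCircle.vec (C : PlaneCircle) : Vec :=
  (exists_represents C).choose

theorem PlaneCircle.represents (C : PlaneCircle) : Represents C.vec C :=
  (exists_represents C).choose_spec

theorem Represents.vec {w : Vec} {C : PlaneCircle} (h : Represents w C) : C.vec = w :=
  C.represents.vec_eq h

theorem vec_injective : Function.Injective PlaneCircle.vec := fun C D h =>
  C.represents.circle_eq (h ▸ D.represents)

theorem exists_vec_eq {w : Vec} (hw : ip w w = 1) : ∃ C : PlaneCircle, C.vec = w :=
  (exists_circle hw).imp fun _ h => h.vec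

theorem isLine_iff (C : PlaneCircle) : C.IsLine ↔ C.vec 0 = 0 := by
  constructor
  · rintro ⟨n, t, hn, hs, hu⟩
    have : Represents (lineVec n t) C :=
      ⟨ip_lineVec t hn, by rw [hs, line_curve_eq], by rw [hu, line_interior_eq]⟩
    rw [this.vec]
    simp [lineVec]
  · intro h0
    have hC := C.represents
    rw [eq_lineVec h0] at hC
    exact ⟨_, _, norm_lineVec C.represents.ip_self h0, by rw [hC.curve_eq, line_curve_eq],
      by rw [hC.interior_eq, line_interior_eq]⟩

theorem powerAt_add (w z : Vec) (x : Plane) : powerAt (w + z) x = powerAt w x + powerAt z x := by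
  simp only [powerAt, Pi.add_apply]; ring

/-- `powerAt w x` is −2 times the product of `w` with the lightlike vector (1, |x|², x), so it has
constant sign on the future cone. Completing squares shows this directly. -/
theorem Future.powerAt_nonneg {w : Vec} (h : Future w) (x : Plane) : 0 ≤ powerAt w x := by
  obtain ⟨h0, h1, h2, -⟩ := h
  simp only [ip] at h2
  rcases h0.eq_or_lt with h0 | h0
  · have h3 : w 2 ^ 2 + w 3 ^ 2 ≤ 0 := by rw [← h0] at h2; linarith
    have h4 : w 2 = 0 := by nlinarith [sq_nonneg (w 2), sq_nonneg (w 3)]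
    have h5 : w 3 = 0 := by nlinarith [sq_nonneg (w 2), sq_nonneg (w 3)]
    simp [powerAt, ← h0, h4, h5, h1]
  · have : 0 ≤ w 0 * powerAt w x := by
      simp only [powerAt]
      nlinarith [sq_nonneg (w 0 * x 0 - w 2), sq_nonneg (w 0 * x 1 - w 3)]
    exact nonneg_of_mul_nonneg_right this h0

theorem disjoint_interior_of_future {A B : PlaneCircle} (h : Future (A.vec + B.vec)) :
    Disjoint A.interior B.interior := by
  rw [Set.disjoint_left]
  intro x hA hB
  rw [A.represents.mem_interior] at hA
  rw [B.represents.mem_interior] at hB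
  have := h.powerAt_nonneg x
  rw [powerAt_add] at this
  linarith

/-- Here a + b is lightlike, so with s its curvature coordinate the two powers add up to s|x − p|²,
which vanishes only at the tangency point p. The case s = 0 is that of two parallel lines. -/
theorem extTangent_of_future {A B : PlaneCircle} (hip : ip A.vec B.vec = -1)
    (h : Future (A.vec + B.vec)) : ExtTangent A B := by
  refine ⟨?_, disjoint_interior_of_future h⟩
  have hA := A.represents
  have hB := B.represents
  set a := A.vec
  set b := B.vec
  have haa := hA.ip_self
  have hbb := hB.ip_self
  obtain ⟨h0, h1, -, h3⟩ := h
  simp only [ip, Pi.add_apply] at h0 h1 hip haa hbb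
  rcases h0.eq_or_lt with h0 | h0
  · left
    have hs : (a 2 + b 2) ^ 2 + (a 3 + b 3) ^ 2 = 0 := by
      linear_combination haa + hbb + 2 * hip - (a 1 + b 1) * h0
    have h2 : a 2 + b 2 = 0 := by nlinarith [sq_nonneg (a 2 + b 2), sq_nonneg (a 3 + b 3)]
    have h4 : a 3 + b 3 = 0 := by nlinarith [sq_nonneg (a 2 + b 2), sq_nonneg (a 3 + b 3)]
    have hb0 : b 0 = -a 0 := by linarith
    have hb2 : b 2 = -a 2 := by linarith
    have hb3 : b 3 = -a 3 := by linarith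
    have h5 : a 0 * (a 1 + b 1) = 0 := by
      rw [hb0, hb2, hb3] at hip
      linear_combination (-2) * haa - 2 * hip
    have h6 : a 1 + b 1 ≠ 0 := by
      intro h6
      apply h3
      funext i
      fin_cases i
      · exact h0.symm
      · exact h6
      · exact h2
      · exact h4
    have ha0 : a 0 = 0 := (mul_eq_zero.1 h5).resolve_right h6
    refine ⟨(isLine_iff A).2 ha0, (isLine_iff B).2 (hb0.trans (by rw [ha0, neg_zero])), ?_⟩
    rw [Set.disjoint_left]
    intro x hxA hxB
    rw [hA.mem_curve] at hxA
    rw [hB.mem_curve] at hxB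
    simp only [powerAt, hb0, hb2, hb3, ha0] at hxA hxB
    apply h6
    linarith
  · right
    refine ⟨fun ⟨hl, hl'⟩ => ?_, ?_⟩
    · rw [isLine_iff] at hl hl'
      simp only [a, b, hl, hl'] at h0
      norm_num at h0
    set s := a 0 + b 0 with hs
    have key : ∀ x : Plane, s * (powerAt a x + powerAt b x) =
        (s * x 0 - (a 2 + b 2)) ^ 2 + (s * x 1 - (a 3 + b 3)) ^ 2 := by
      intro x
      simp only [powerAt, hs]
      linear_combination (-1) * haa - hbb - 2 * hip
    refine ⟨!₂[(a 2 + b 2) / s, (a 3 + b 3) / s], ⟨?_, ?_⟩, ?_⟩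
    · rw [hA.mem_curve]
      simp [powerAt]
      field_simp
      simp only [hs]
      linear_combination (-a 0 - 2 * b 0) * haa + a 0 * hbb - (2 * b 0) * hip
    · rw [hB.mem_curve]
      simp [powerAt]
      field_simp
      simp only [hs]
      linear_combination b 0 * haa + (-b 0 - 2 * a 0) * hbb - (2 * a 0) * hip
    · rintro x ⟨hxA, hxB⟩
      rw [hA.mem_curve] at hxA
      rw [hB.mem_curve] at hxB
      have hk := key x
      rw [hxA, hxB] at hk
      have h4 : s * x 0 - (a 2 + b 2) = 0 := by
        nlinarith [sq_nonneg (s * x 0 - (a 2 + b 2)), sq_nonneg (s * x 1 - (a 3 + b 3))]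
      have h5 : s * x 1 - (a 3 + b 3) = 0 := by
        nlinarith [sq_nonneg (s * x 0 - (a 2 + b 2)), sq_nonneg (s * x 1 - (a 3 + b 3))]
      apply plane_ext
      · simp
        field_simp
        linarith
      · simp
        field_simp
        linarith

theorem ip_ge_neg_one_of_unit {a b c d : ℝ} (h1 : a ^ 2 + b ^ 2 = 1) (h2 : c ^ 2 + d ^ 2 = 1) :
    -1 ≤ a * c + b * d := by
  nlinarith [sq_nonneg (a + c), sq_nonneg (b + d)]

/-- At a common point the inner product is the cosine of the angle between the inward normals.
Unless it is −1, a small step along the sum of the normals enters both interiors; for two lines a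
long step does. -/
theorem ExtTangent.ip_eq {A B : PlaneCircle} (h : ExtTangent A B) : ip A.vec B.vec = -1 := by
  obtain ⟨ht, hd⟩ := h
  have hA := A.represents
  have hB := B.represents
  rw [Set.disjoint_left] at hd
  have hd' : ∀ x y : ℝ, powerAt A.vec !₂[x, y] < 0 → ¬ powerAt B.vec !₂[x, y] < 0 :=
    fun x y h1 h2 => hd ((hA.mem_interior _).2 h1) ((hB.mem_interior _).2 h2)
  have haa := hA.ip_self
  have hbb := hB.ip_self
  by_contra hne
  rcases ht with ⟨hla, hlb, -⟩ | ⟨-, p, ⟨hpA, hpB⟩, -⟩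
  · rw [isLine_iff] at hla hlb
    set a := A.vec
    set b := B.vec
    simp only [ip, hla, hlb] at haa hbb hne
    have hge := ip_ge_neg_one_of_unit (a := a 2) (b := a 3) (c := b 2) (d := b 3)
      (by linarith) (by linarith)
    have hpos : 0 < 1 + (a 2 * b 2 + a 3 * b 3) := by
      rcases hge.lt_or_eq with h | h
      · linarith
      · exact absurd (by rw [← h]; ring) hne
    set c := a 2 * b 2 + a 3 * b 3 with hc
    -- Large enough for −2k(1 + c) to outweigh both constant terms `a 1` and `b 1`.
    set k := (|a 1| + |b 1| + 1) / (1 + c) with hk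
    have hkc : k * (1 + c) = |a 1| + |b 1| + 1 := by rw [hk]; field_simp
    apply hd' (k * (a 2 + b 2)) (k * (a 3 + b 3))
    · have : powerAt a !₂[k * (a 2 + b 2), k * (a 3 + b 3)] = -2 * (k * (1 + c)) + a 1 := by
        simp [powerAt, hla, hc]
        linear_combination k * haa
      rw [this, hkc]
      linarith [le_abs_self (a 1), abs_nonneg (a 1), abs_nonneg (b 1)]
    · have : powerAt b !₂[k * (a 2 + b 2), k * (a 3 + b 3)] = -2 * (k * (1 + c)) + b 1 := by
        simp [powerAt, hlb, hc]
        linear_combination k * hbb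
      rw [this, hkc]
      linarith [le_abs_self (b 1), abs_nonneg (a 1), abs_nonneg (b 1)]
  · rw [hA.mem_curve] at hpA
    rw [hB.mem_curve] at hpB
    set a := A.vec
    set b := B.vec
    simp only [powerAt] at hpA hpB
    simp only [ip] at haa hbb hne
    -- (n, m) and (n', m') are the unit inward normals of the two circles at `p`.
    obtain ⟨n, hn⟩ : ∃ n, n = a 2 - a 0 * p 0 := ⟨_, rfl⟩
    obtain ⟨m, hm⟩ : ∃ m, m = a 3 - a 0 * p 1 := ⟨_, rfl⟩
    obtain ⟨n', hn'⟩ : ∃ n, n = b 2 - b 0 * p 0 := ⟨_, rfl⟩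
    obtain ⟨m', hm'⟩ : ∃ m, m = b 3 - b 0 * p 1 := ⟨_, rfl⟩
    have h1 : n ^ 2 + m ^ 2 = 1 := by
      rw [hn, hm]; linear_combination haa + a 0 * hpA
    have h2 : n' ^ 2 + m' ^ 2 = 1 := by
      rw [hn', hm']; linear_combination hbb + b 0 * hpB
    have h3 : a 2 * b 2 + a 3 * b 3 - (a 0 * b 1 + a 1 * b 0) / 2 = n * n' + m * m' := by
      rw [hn, hm, hn', hm']
      linear_combination (-a 0 / 2) * hpB - b 0 / 2 * hpA
    rw [h3] at hne
    have hpos : 0 < 1 + (n * n' + m * m') := by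
      rcases (ip_ge_neg_one_of_unit h1 h2).lt_or_eq with h | h
      · linarith
      · exact absurd h.symm hne
    obtain ⟨c, hc⟩ : ∃ c, c = n * n' + m * m' := ⟨_, rfl⟩
    rw [← hc] at hpos
    -- A step so short that the curvature terms e·`a 0` and e·`b 0` stay below 1.
    obtain ⟨e, he⟩ : ∃ e, e = 1 / (|a 0| + |b 0| + 1) := ⟨_, rfl⟩
    have he0 : 0 < e := by rw [he]; positivity
    have he1 : e * (|a 0| + |b 0| + 1) = 1 := by rw [he]; field_simp
    apply hd' (p 0 + e * (n + n')) (p 1 + e * (m + m'))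
    · have : powerAt a !₂[p 0 + e * (n + n'), p 1 + e * (m + m')] =
          e * (1 + c) * (2 * (e * a 0) - 2) := by
        simp [powerAt]
        linear_combination hpA + e ^ 2 * a 0 * (h1 + h2 - 2 * hc)
          + 2 * e * (n + n') * hn + 2 * e * (m + m') * hm - 2 * e * (h1 - hc)
      rw [this]
      have : e * a 0 < 1 := by
        rw [← he1]
        exact mul_lt_mul_of_pos_left (by linarith [le_abs_self (a 0), abs_nonneg (b 0)]) he0
      exact mul_neg_of_pos_of_neg (by positivity) (by linarith)
    · have : powerAt b !₂[p 0 + e * (n + n'), p 1 + e * (m + m')] =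
          e * (1 + c) * (2 * (e * b 0) - 2) := by
        simp [powerAt]
        linear_combination hpB + e ^ 2 * b 0 * (h1 + h2 - 2 * hc)
          + 2 * e * (n + n') * hn' + 2 * e * (m + m') * hm' - 2 * e * (h2 - hc)
      rw [this]
      have : e * b 0 < 1 := by
        rw [← he1]
        exact mul_lt_mul_of_pos_left (by linarith [le_abs_self (b 0), abs_nonneg (a 0)]) he0
      exact mul_neg_of_pos_of_neg (by positivity) (by linarith)

/-! ### The generated packing as an orbit -/

theorem stage_mono (T : Set PlaneCircle) : Monotone (stage T) :=
  monotone_nat_of_le_succ fun _ => Set.subset_union_left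

theorem subset_generatedPacking (T : Set PlaneCircle) : T ⊆ generatedPacking T :=
  Set.subset_iUnion (stage T) 0

theorem generatedPacking_closed {T : Set PlaneCircle} {A B C D : PlaneCircle}
    (hA : A ∈ generatedPacking T) (hB : B ∈ generatedPacking T) (hC : C ∈ generatedPacking T)
    (h : MutuallyTangent A B C) (hDA : ExtTangent D A) (hDB : ExtTangent D B)
    (hDC : ExtTangent D C) : D ∈ generatedPacking T := by
  obtain ⟨i, hi⟩ := Set.mem_iUnion.1 hA
  obtain ⟨j, hj⟩ := Set.mem_iUnion.1 hB
  obtain ⟨k, hk⟩ := Set.mem_iUnion.1 hC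
  have hm := stage_mono T
  let N := max i (max j k)
  refine Set.mem_iUnion.2 ⟨N + 1, Or.inr ⟨A, hm (le_max_left _ _) hi, B,
    hm ((le_max_left _ _).trans (le_max_right _ _)) hj, C,
    hm ((le_max_right _ _).trans (le_max_right _ _)) hk, h, hDA, hDB, hDC⟩⟩

theorem generatedPacking_subset {T Q : Set PlaneCircle} (hT : T ⊆ Q)
    (hQ : ∀ A ∈ Q, ∀ B ∈ Q, ∀ C ∈ Q, MutuallyTangent A B C →
      ∀ D : PlaneCircle, ExtTangent D A → ExtTangent D B → ExtTangent D C → D ∈ Q) :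
    generatedPacking T ⊆ Q := by
  refine Set.iUnion_subset fun n => ?_
  induction n with
  | zero => exact hT
  | succ n ih =>
    rintro D (hD | ⟨A, hA, B, hB, C, hC, h, h1, h2, h3⟩)
    · exact ih hD
    · exact hQ A (ih hA) B (ih hB) C (ih hC) h D h1 h2 h3

/-- The set of circles with coordinates in the orbit of a Descartes quadruple. -/
def orbitCircles (q : Fin 4 → Vec) : Set PlaneCircle := {C | C.vec ∈ orbit q}

theorem orbitCircles_closed {q : Fin 4 → Vec} (hq : IsDescartes q) :
    ∀ A ∈ orbitCircles q, ∀ B ∈ orbitCircles q, ∀ C ∈ orbitCircles q, MutuallyTangent A B C →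
      ∀ D : PlaneCircle, ExtTangent D A → ExtTangent D B → ExtTangent D C →
        D ∈ orbitCircles q :=
  fun _ hA _ hB _ hC ⟨hab, hbc, hac⟩ D hda hdb hdc =>
    orbit_closed hq hA hB hC hab.ip_eq hbc.ip_eq hac.ip_eq D.represents.ip_self
      hda.ip_eq hdb.ip_eq hdc.ip_eq

theorem extTangent_of_mem_orbit {q : Fin 4 → Vec} (hq : IsDescartes q)
    (hZ : Future (q 0 + q 1 + q 2 + q 3)) {A B : PlaneCircle} (hA : A.vec ∈ orbit q)
    (hB : B.vec ∈ orbit q) (h : ip A.vec B.vec = -1) : ExtTangent A B := by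
  refine extTangent_of_future h (future_add_of_mem_orbit hq hZ hA hB ?_)
  intro he
  rw [he, A.represents.ip_self] at h
  norm_num at h

theorem exists_others (k : Fin 4) : ∃ a b c : Fin 4, a ≠ b ∧ b ≠ c ∧ a ≠ c ∧
    a ≠ k ∧ b ≠ k ∧ c ≠ k := by
  revert k
  decide

/-- Any three circles of a Descartes quadruple generate the orbit of the quadruple. -/
theorem generatedPacking_eq {q : Fin 4 → Vec} (hq : IsDescartes q)
    (hZ : Future (q 0 + q 1 + q 2 + q 3)) {T : Set PlaneCircle} {l : Fin 4}
    (hT : ∀ C : PlaneCircle, C ∈ T ↔ ∃ i, i ≠ l ∧ C.vec = q i) :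
    generatedPacking T = orbitCircles q := by
  apply Set.Subset.antisymm
  · refine generatedPacking_subset (fun C hC => ?_) (orbitCircles_closed hq)
    obtain ⟨i, -, hi⟩ := (hT C).1 hC
    exact (congrArg (· ∈ orbit q) hi).mpr (mem_orbit_self q i)
  · have hclosed : ∀ r : Fin 4 → Vec, Reach q r → ∀ k,
        (∀ i, i ≠ k → ∀ C : PlaneCircle, C.vec = r i → C ∈ generatedPacking T) →
        ∀ C : PlaneCircle, C.vec = r k → C ∈ generatedPacking T := by
      intro r hr k h D hD
      have hr' := hr.isDescartes hq
      obtain ⟨a, b, c, hab, hbc, hac, ha, hb, hc⟩ := exists_others k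
      obtain ⟨A, hA⟩ := exists_vec_eq (hr'.self a)
      obtain ⟨B, hB⟩ := exists_vec_eq (hr'.self b)
      obtain ⟨C, hC⟩ := exists_vec_eq (hr'.self c)
      have key : ∀ (i j : Fin 4) (X Y : PlaneCircle), i ≠ j → X.vec = r i → Y.vec = r j →
          ExtTangent X Y := by
        intro i j X Y hij hX hY
        refine extTangent_of_mem_orbit hq hZ ?_ ?_ ?_
        · rw [hX]; exact hr.mem_orbit i
        · rw [hY]; exact hr.mem_orbit j
        · rw [hX, hY, hr'.ne hij]
      exact generatedPacking_closed (h a ha A hA) (h b hb B hB) (h c hc C hC)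
        ⟨key a b A B hab hA hB, key b c B C hbc hB hC, key a c A C hac hA hC⟩
        (key k a D A ha.symm hD hA) (key k b D B hb.symm hD hB) (key k c D C hc.symm hD hC)
    have hall : ∀ r : Fin 4 → Vec, Reach q r → ∀ i, ∀ C : PlaneCircle, C.vec = r i →
        C ∈ generatedPacking T := by
      intro r hr
      induction hr with
      | refl =>
        have h0 : ∀ i, i ≠ l → ∀ C : PlaneCircle, C.vec = q i → C ∈ generatedPacking T :=
          fun i hi C hC => subset_generatedPacking T ((hT C).2 ⟨i, hi, hC⟩)
        intro i
        by_cases hi : i = l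
        · subst hi
          exact hclosed q Relation.ReflTransGen.refl i h0
        · exact h0 i hi
      | @tail r _ hr' h ih =>
        obtain ⟨k, rfl⟩ := h
        have h0 : ∀ i, i ≠ k → ∀ C : PlaneCircle, C.vec = reflect r k i →
            C ∈ generatedPacking T := by
          intro i hi C hC
          rw [reflect_of_ne _ hi] at hC
          exact ih i C hC
        intro i
        by_cases hi : i = k
        · subst hi
          exact hclosed _ (hr'.tail ⟨_, rfl⟩) i h0
        · exact h0 i hi
    rintro C ⟨r, hr, i, hi⟩
    exact hall r hr i C hi

/-! ### Symmetries -/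

theorem isLine_map (Φ : Similarity) (A : PlaneCircle) : (A.map Φ).IsLine ↔ A.IsLine := by
  constructor
  · intro h
    have : ((A.map Φ).map Φ⁻¹).IsLine := IsLineWithSide.image h Φ⁻¹
    rwa [← PlaneCircle.map_mul, inv_mul_cancel, PlaneCircle.map_one] at this
  · intro h
    exact IsLineWithSide.image h Φ

theorem extTangent_map (Φ : Similarity) {A B : PlaneCircle} :
    ExtTangent (A.map Φ) (B.map Φ) ↔ ExtTangent A B := by
  have hinj : Function.Injective Φ := Φ.injective
  have h1 : Disjoint (A.map Φ).curve (B.map Φ).curve ↔ Disjoint A.curve B.curve :=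
    Set.disjoint_image_iff hinj
  have h2 : Disjoint (A.map Φ).interior (B.map Φ).interior ↔ Disjoint A.interior B.interior :=
    Set.disjoint_image_iff hinj
  have h3 : (∃! x, x ∈ (A.map Φ).curve ∩ (B.map Φ).curve) ↔ ∃! x, x ∈ A.curve ∩ B.curve := by
    have : (A.map Φ).curve ∩ (B.map Φ).curve = Φ '' (A.curve ∩ B.curve) :=
      (Set.image_inter hinj).symm
    rw [this]
    constructor
    · rintro ⟨_, ⟨x, hx, rfl⟩, hu⟩
      exact ⟨x, hx, fun y hy => hinj (hu _ ⟨y, hy, rfl⟩)⟩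
    · rintro ⟨x, hx, hu⟩
      exact ⟨Φ x, ⟨x, hx, rfl⟩, by rintro _ ⟨y, hy, rfl⟩; rw [hu y hy]⟩
  simp only [ExtTangent, Tangent, isLine_map, h1, h2, h3]

theorem mutuallyTangent_map (Φ : Similarity) {A B C : PlaneCircle} :
    MutuallyTangent (A.map Φ) (B.map Φ) (C.map Φ) ↔ MutuallyTangent A B C := by
  simp only [MutuallyTangent, extTangent_map]

theorem image_stage (Φ : Similarity) (T : Set PlaneCircle) (n : ℕ) :
    PlaneCircle.map Φ '' stage T n = stage (PlaneCircle.map Φ '' T) n := by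
  induction n with
  | zero => rfl
  | succ n ih =>
    simp only [stage, Set.image_union, ← ih]
    congr 1
    ext D
    constructor
    · rintro ⟨D, ⟨A, hA, B, hB, C, hC, h, h1, h2, h3⟩, rfl⟩
      exact ⟨_, ⟨A, hA, rfl⟩, _, ⟨B, hB, rfl⟩, _, ⟨C, hC, rfl⟩, (mutuallyTangent_map Φ).2 h,
        (extTangent_map Φ).2 h1, (extTangent_map Φ).2 h2, (extTangent_map Φ).2 h3⟩
    · rintro ⟨_, ⟨A, hA, rfl⟩, _, ⟨B, hB, rfl⟩, _, ⟨C, hC, rfl⟩, h, h1, h2, h3⟩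
      have hD : D = PlaneCircle.map Φ (PlaneCircle.map Φ⁻¹ D) := by
        rw [← PlaneCircle.map_mul, mul_inv_cancel, PlaneCircle.map_one]
      rw [hD] at h1 h2 h3
      exact ⟨_, ⟨A, hA, B, hB, C, hC, (mutuallyTangent_map Φ).1 h, (extTangent_map Φ).1 h1,
        (extTangent_map Φ).1 h2, (extTangent_map Φ).1 h3⟩, hD.symm⟩

theorem image_generatedPacking (Φ : Similarity) (T : Set PlaneCircle) :
    PlaneCircle.map Φ '' generatedPacking T = generatedPacking (PlaneCircle.map Φ '' T) := by
  simp only [generatedPacking, Set.image_iUnion, image_stage]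

/-- Three mutually tangent circles of the packing generate it. -/
theorem generatedPacking_triple {q : Fin 4 → Vec} (hq : IsDescartes q)
    (hZ : Future (q 0 + q 1 + q 2 + q 3)) {A B C : PlaneCircle} (h : MutuallyTangent A B C)
    (hA : A ∈ orbitCircles q) (hB : B ∈ orbitCircles q) (hC : C ∈ orbitCircles q) :
    generatedPacking {A, B, C} = orbitCircles q := by
  obtain ⟨r, hr, i, j, k, hij, hjk, hik, ha, hb, hc⟩ := exists_reach_of_triple hq hA hB hC
    h.1.ip_eq h.2.1.ip_eq h.2.2.ip_eq
  obtain ⟨l, hl⟩ := exists_fourth hij hjk hik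
  have hr' := hr.isDescartes hq
  rw [generatedPacking_eq hr' (hr.future hq hZ) (l := l)]
  · simp only [orbitCircles, hr.orbit_eq]
  · intro X
    simp only [Set.mem_insert_iff, Set.mem_singleton_iff]
    constructor
    · rintro (rfl | rfl | rfl)
      · exact ⟨i, (hl i).2 (Or.inl rfl), ha⟩
      · exact ⟨j, (hl j).2 (Or.inr (Or.inl rfl)), hb⟩
      · exact ⟨k, (hl k).2 (Or.inr (Or.inr rfl)), hc⟩
    · rintro ⟨m, hm, hX⟩
      rcases (hl m).1 hm with rfl | rfl | rfl
      · exact Or.inl (vec_injective (hX.trans ha.symm))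
      · exact Or.inr (Or.inl (vec_injective (hX.trans hb.symm)))
      · exact Or.inr (Or.inr (vec_injective (hX.trans hc.symm)))

/-- A similarity that maps three mutually tangent circles of a packing into the packing is a
symmetry of the packing. -/
theorem mem_symm_of_triple {q : Fin 4 → Vec} (hq : IsDescartes q)
    (hZ : Future (q 0 + q 1 + q 2 + q 3)) {A B C : PlaneCircle} (h : MutuallyTangent A B C)
    (hA : A ∈ orbitCircles q) (hB : B ∈ orbitCircles q) (hC : C ∈ orbitCircles q)
    {Φ : Similarity} (hA' : A.map Φ ∈ orbitCircles q) (hB' : B.map Φ ∈ orbitCircles q)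
    (hC' : C.map Φ ∈ orbitCircles q) : Φ ∈ Symm (orbitCircles q) := by
  change PlaneCircle.map Φ '' orbitCircles q = orbitCircles q
  -- Generation commutes with similarities, so the image is generated by the image triple, which
  -- again generates the packing.
  conv_lhs => rw [← generatedPacking_triple hq hZ h hA hB hC]
  rw [image_generatedPacking, Set.image_insert_eq, Set.image_insert_eq, Set.image_singleton]
  exact generatedPacking_triple hq hZ ((mutuallyTangent_map Φ).2 h) hA' hB' hC'

theorem map_mem_of_mem_symm {P : Set PlaneCircle} {Φ : Similarity} (h : Φ ∈ Symm P)
    {C : PlaneCircle} (hC : C ∈ P) : C.map Φ ∈ P := by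
  have : PlaneCircle.map Φ '' P = P := h
  rw [← this]
  exact ⟨C, hC, rfl⟩

theorem disjoint_interior_of_mem_orbitCircles {q : Fin 4 → Vec} (hq : IsDescartes q)
    (hZ : Future (q 0 + q 1 + q 2 + q 3)) {A B : PlaneCircle} (hA : A ∈ orbitCircles q)
    (hB : B ∈ orbitCircles q) (hne : A ≠ B) : Disjoint A.interior B.interior :=
  disjoint_interior_of_future
    (future_add_of_mem_orbit hq hZ hA hB fun h => hne (vec_injective h.symm))

theorem isApollonianPacking_orbitCircles {q : Fin 4 → Vec} (hq : IsDescartes q)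
    (hZ : Future (q 0 + q 1 + q 2 + q 3)) : IsApollonianPacking (orbitCircles q) where
  disjoint_interiors _ hA _ hB hne := disjoint_interior_of_mem_orbitCircles hq hZ hA hB hne
  exists_triple := by
    obtain ⟨A, hA⟩ := exists_vec_eq (hq.self 0)
    obtain ⟨B, hB⟩ := exists_vec_eq (hq.self 1)
    obtain ⟨C, hC⟩ := exists_vec_eq (hq.self 2)
    have key : ∀ {X Y : PlaneCircle} (i j : Fin 4), i ≠ j → X.vec = q i → Y.vec = q j →
        ExtTangent X Y := by
      intro X Y i j hij hX hY
      refine extTangent_of_mem_orbit hq hZ ?_ ?_ (by rw [hX, hY, hq.ne hij])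
      · rw [hX]; exact mem_orbit_self q i
      · rw [hY]; exact mem_orbit_self q j
    refine ⟨A, ?_, B, ?_, C, ?_, key 0 1 (by decide) hA hB, key 1 2 (by decide) hB hC,
      key 0 2 (by decide) hA hC⟩
    · rw [orbitCircles, Set.mem_ofPred_eq, hA]; exact mem_orbit_self q 0
    · rw [orbitCircles, Set.mem_ofPred_eq, hB]; exact mem_orbit_self q 1
    · rw [orbitCircles, Set.mem_ofPred_eq, hC]; exact mem_orbit_self q 2
  closed := orbitCircles_closed hq

/-! ### Circles tangent to the `x`-axis -/

/-- The coordinates of the circle of curvature `s ^ 2` resting on the `x`-axis at `2 * t / s`. -/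
def fordVec (t s : ℝ) : Vec := ![s ^ 2, 4 * t ^ 2, 2 * t * s, 1]

/-- The coordinates of the `x`-axis. -/
def axisVec : Vec := ![0, 0, 0, -1]

/-- The Ford circle of the packing with index `(m, n)`. -/
noncomputable def fordInt (α : ℝ) (m n : ℤ) : Vec := fordVec (n / α) (m * α + n)

/-- The Descartes quadruple containing the generators of the packing. -/
noncomputable def baseQuad (α : ℝ) : Fin 4 → Vec :=
  ![fordInt α 1 0, fordInt α 0 1, axisVec, fordInt α 1 1]

theorem ip_fordVec (t s t' s' : ℝ) :
    ip (fordVec t s) (fordVec t' s') = 1 - 2 * (t * s' - t' * s) ^ 2 := by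
  simp [ip, fordVec]; ring

theorem ip_axisVec_fordVec (t s : ℝ) : ip axisVec (fordVec t s) = -1 := by
  simp [ip, fordVec, axisVec]

theorem ip_axisVec_self : ip axisVec axisVec = 1 := by simp [ip, axisVec]

theorem ip_fordInt {α : ℝ} (hα : 0 < α) (m n m' n' : ℤ) :
    ip (fordInt α m n) (fordInt α m' n') = 1 - 2 * ((m * n' - m' * n : ℤ) : ℝ) ^ 2 := by
  rw [fordInt, fordInt, ip_fordVec]
  push_cast
  field_simp
  ring

theorem ip_axisVec_fordInt (α : ℝ) (m n : ℤ) : ip axisVec (fordInt α m n) = -1 :=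
  ip_axisVec_fordVec _ _

theorem fordInt_neg (α : ℝ) (m n : ℤ) : fordInt α (-m) (-n) = fordInt α m n := by
  funext i
  fin_cases i <;> simp [fordInt, fordVec] <;> ring

theorem isDescartes_baseQuad {α : ℝ} (hα : 0 < α) : IsDescartes (baseQuad α) := by
  intro i j
  fin_cases i <;> fin_cases j <;>
    simp [baseQuad, ip_fordInt hα, ip_axisVec_fordInt, ip_axisVec_self,
      ip_comm (fordInt _ _ _) axisVec] <;> norm_num

theorem future_baseQuad {α : ℝ} (hα : 0 < α) :
    Future (baseQuad α 0 + baseQuad α 1 + baseQuad α 2 + baseQuad α 3) := by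
  have h0 : 0 < (baseQuad α 0 + baseQuad α 1 + baseQuad α 2 + baseQuad α 3) 0 := by
    simp [baseQuad, fordInt, fordVec, axisVec]
    positivity
  refine ⟨h0.le, ?_, ?_, ?_⟩
  · simp [baseQuad, fordInt, fordVec, axisVec]
    positivity
  · have := (isDescartes_baseQuad hα).sum_eq
    simp only [ip_add_left]
    simp only [ip_add_right]
    linarith [this 0, this 1, this 2, this 3]
  · intro h
    rw [h] at h0
    exact lt_irrefl _ h0

theorem vec_xAxis : xAxis.vec = axisVec := by
  rw [xAxis, (represents_line _ _ _).vec]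
  funext i
  fin_cases i <;> simp [lineVec, axisVec]

theorem vec_disc {c : Plane} {r : ℝ} (hr : 0 < r) : (disc c r hr).vec = roundVec c r :=
  (represents_disc c r hr).vec

theorem packing_eq {α : ℝ} (hα : 0 < α) : packing α hα = orbitCircles (baseQuad α) := by
  refine generatedPacking_eq (isDescartes_baseQuad hα) (future_baseQuad hα) (l := 3) ?_
  have h1 : (disc !₂[0, 1 / α ^ 2] (1 / α ^ 2) (by positivity)).vec = fordInt α 1 0 := by
    rw [vec_disc]
    funext i
    fin_cases i <;> simp [roundVec, fordInt, fordVec, hα.ne']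
  have h2 : (disc !₂[2 / α, 1] 1 one_pos).vec = fordInt α 0 1 := by
    rw [vec_disc]
    funext i
    fin_cases i <;> simp [roundVec, fordInt, fordVec] <;> ring
  intro C
  simp only [Set.mem_insert_iff, Set.mem_singleton_iff]
  constructor
  · rintro (rfl | rfl | rfl)
    · exact ⟨0, by decide, h1⟩
    · exact ⟨1, by decide, h2⟩
    · exact ⟨2, by decide, vec_xAxis⟩
  · rintro ⟨i, hi, hC⟩
    fin_cases i
    · exact Or.inl (vec_injective (hC.trans h1.symm))
    · exact Or.inr (Or.inl (vec_injective (hC.trans h2.symm)))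
    · exact Or.inr (Or.inr (vec_injective (hC.trans vec_xAxis.symm)))
    · exact absurd rfl hi

theorem axisVec_mem (α : ℝ) : axisVec ∈ orbit (baseQuad α) := mem_orbit_self (baseQuad α) 2

theorem sq_det_eq_one {a : ℤ} (h : 1 - 2 * (a : ℝ) ^ 2 = -1) : a ^ 2 = 1 := by
  have : (a : ℝ) ^ 2 = 1 := by linarith
  exact_mod_cast this

theorem isCoprime_of_det {m n m' n' : ℤ} (h : (m * n' - m' * n) ^ 2 = 1) : IsCoprime m n :=
  ⟨(m * n' - m' * n) * n', -(m * n' - m' * n) * m', by linear_combination h⟩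

theorem exists_two_others {j : Fin 4} (hj : j ≠ 2) :
    ∃ a b : Fin 4, a ≠ b ∧ a ≠ 2 ∧ b ≠ 2 ∧ ∀ i, i ≠ j → i = 2 ∨ i = a ∨ i = b := by
  revert j
  decide

/-- The circles of the packing tangent to the `x`-axis are Ford circles with coprime indices. -/
theorem exists_eq_fordInt {α : ℝ} (hα : 0 < α) {w : Vec} (hw : w ∈ orbit (baseQuad α))
    (h : ip axisVec w = -1) : ∃ m n : ℤ, IsCoprime m n ∧ w = fordInt α m n := by
  obtain ⟨q, hq, ⟨l, rfl⟩, hfix⟩ := exists_of_ip_eq (isDescartes_baseQuad hα) hw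
  obtain ⟨h2, hI⟩ := hfix 2 h
  have h2' : q 2 = axisVec := h2
  refine hI (fun r => ∀ j, j ≠ 2 → ∃ m n : ℤ, IsCoprime m n ∧ r j = fordInt α m n) ?_ ?_ l ?_
  · intro j hj
    fin_cases j
    · exact ⟨1, 0, isCoprime_one_left, rfl⟩
    · exact ⟨0, 1, isCoprime_one_right, rfl⟩
    · exact absurd rfl hj
    · exact ⟨1, 1, isCoprime_one_left, rfl⟩
  · intro r j hr hj hr2 hIr i hi
    by_cases hij : i = j
    · subst hij
      have hr2 : r 2 = axisVec := hr2
      obtain ⟨a, b, hab, ha, hb, hall⟩ := exists_two_others hi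
      obtain ⟨m, n, -, hmn⟩ := hIr a ha
      obtain ⟨m', n', -, hmn'⟩ := hIr b hb
      have hdet : (m * n' - m' * n) ^ 2 = 1 := by
        have := hr.ne hab
        rw [hmn, hmn', ip_fordInt hα] at this
        exact sq_det_eq_one this
      -- The two circles tangent to the axis and to the circles (m, n) and (m', n') have the Farey
      -- sum and difference as indices.
      have hcand : ∀ e : ℤ, e ^ 2 = 1 → fordInt α (m + e * m') (n + e * n') = r i ∨
          fordInt α (m + e * m') (n + e * n') = reflect r i i := by
        intro e he
        refine hr.eq_or_eq i ?_ fun k hk => ?_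
        · rw [ip_fordInt hα, show (m + e * m') * (n + e * n') - (m + e * m') * (n + e * n') = 0
            by ring]
          simp
        · rcases hall k hk with rfl | rfl | rfl
          · rw [hr2, ip_comm, ip_axisVec_fordInt]
          · rw [hmn, ip_fordInt hα]
            have : ((m + e * m') * n - m * (n + e * n')) ^ 2 = 1 := by
              linear_combination e ^ 2 * hdet + he
            rw [← Int.cast_pow, this]; norm_num
          · rw [hmn', ip_fordInt hα]
            have : ((m + e * m') * n' - m' * (n + e * n')) ^ 2 = 1 := by
              linear_combination hdet
            rw [← Int.cast_pow, this]; norm_num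
      have hcop : ∀ e : ℤ, IsCoprime (m + e * m') (n + e * n') := fun e =>
        isCoprime_of_det (m' := m') (n' := n') (by linear_combination hdet)
      rcases hcand 1 (by norm_num) with h1 | h1
      · rcases hcand (-1) (by norm_num) with h3 | h3
        · exfalso
          -- Sum and difference have determinant ±2, so they cannot both be `r i`; one of them is
          -- the reflected circle.
          have h4 : ip (fordInt α (m + 1 * m') (n + 1 * n'))
              (fordInt α (m + -1 * m') (n + -1 * n')) = 1 := by
            rw [h1, h3, hr.self]
          rw [ip_fordInt hα, ← Int.cast_pow, show ((m + 1 * m') * (n + -1 * n')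
            - (m + -1 * m') * (n + 1 * n')) ^ 2 = 4 by linear_combination 4 * hdet] at h4
          norm_num at h4
        · exact ⟨_, _, hcop _, h3.symm⟩
      · exact ⟨_, _, hcop _, h1.symm⟩
    · rw [reflect_of_ne _ hij]
      exact hIr i hi
  · rintro rfl
    rw [h2', ip_axisVec_self] at h
    norm_num at h

theorem fordInt_add_mem {α : ℝ} (hα : 0 < α) {m n m' n' : ℤ}
    (h : fordInt α m n ∈ orbit (baseQuad α)) (h' : fordInt α m' n' ∈ orbit (baseQuad α))
    (hdet : (m * n' - m' * n) ^ 2 = 1) :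
    fordInt α (m + m') (n + n') ∈ orbit (baseQuad α) := by
  have key : ∀ a b c d : ℤ, (a * d - c * b) ^ 2 = 1 →
      ip (fordInt α a b) (fordInt α c d) = -1 := by
    intro a b c d h
    rw [ip_fordInt hα, ← Int.cast_pow, h]; norm_num
  refine orbit_closed (isDescartes_baseQuad hα) (axisVec_mem α) h h' (ip_axisVec_fordInt _ _ _)
    (key _ _ _ _ hdet) (ip_axisVec_fordInt _ _ _) ?_ ?_ ?_ ?_
  · rw [ip_fordInt hα, show (m + m') * (n + n') - (m + m') * (n + n') = 0 by ring]
    simp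
  · rw [ip_comm, ip_axisVec_fordInt]
  · exact key _ _ _ _ (by linear_combination hdet)
  · exact key _ _ _ _ (by linear_combination hdet)

-- Induction over words in the generators S and T: right multiplication by S swaps the columns up to
-- sign, which `fordInt_neg` absorbs, and by T^±1 adds or subtracts the first column, which is a
-- Farey step.
open Matrix in
theorem fordInt_columns_mem {α : ℝ} (hα : 0 < α) (g : SpecialLinearGroup (Fin 2) ℤ) :
    fordInt α (g 0 0) (g 1 0) ∈ orbit (baseQuad α) ∧
      fordInt α (g 0 1) (g 1 1) ∈ orbit (baseQuad α) := by
  have hmul : ∀ (x y : SpecialLinearGroup (Fin 2) ℤ) (i j : Fin 2),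
      (x * y) i j = x i 0 * y 0 j + x i 1 * y 1 j := by
    intro x y i j
    change (x.1 * y.1) i j = _
    rw [Matrix.mul_apply, Fin.sum_univ_two]
  have hinv : ∀ y : SpecialLinearGroup (Fin 2) ℤ, y⁻¹ 0 0 = y 1 1 ∧ y⁻¹ 0 1 = -y 0 1 ∧
      y⁻¹ 1 0 = -y 1 0 ∧ y⁻¹ 1 1 = y 0 0 := by
    intro y
    simp [Matrix.adjugate_fin_two]
  have hS : ModularGroup.S 0 0 = 0 ∧ ModularGroup.S 0 1 = -1 ∧ ModularGroup.S 1 0 = 1 ∧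
      ModularGroup.S 1 1 = 0 := ⟨rfl, rfl, rfl, rfl⟩
  have hT : ModularGroup.T 0 0 = 1 ∧ ModularGroup.T 0 1 = 1 ∧ ModularGroup.T 1 0 = 0 ∧
      ModularGroup.T 1 1 = 1 := ⟨rfl, rfl, rfl, rfl⟩
  have hg : g ∈ Subgroup.closure {ModularGroup.S, ModularGroup.T} := by
    rw [SpecialLinearGroup.SL2Z_generators]; trivial
  induction hg using Subgroup.closure_induction_right with
  | one => exact ⟨mem_orbit_self (baseQuad α) 0, mem_orbit_self (baseQuad α) 1⟩
  | mul_right x y hx hy ih =>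
    have hdet : x 0 0 * x 1 1 - x 0 1 * x 1 0 = 1 := by
      rw [← det_fin_two]; exact x.det_coe
    rcases hy with rfl | rfl
    · simp only [hmul, hS, mul_zero, mul_one, zero_add, add_zero, mul_neg, fordInt_neg]
      exact ih.symm
    · simp only [hmul, hT, mul_zero, mul_one, add_zero]
      exact ⟨ih.1, fordInt_add_mem hα ih.1 ih.2 (by rw [hdet]; rfl)⟩
  | mul_inv_cancel x y hx hy ih =>
    have hdet : x 0 0 * x 1 1 - x 0 1 * x 1 0 = 1 := by
      rw [← det_fin_two]; exact x.det_coe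
    rcases hy with rfl | rfl
    · simp only [hmul, hinv, hS, mul_zero, mul_one, zero_add, add_zero, mul_neg, neg_neg,
        fordInt_neg]
      exact ih.symm
    · simp only [hmul, hinv, hT, mul_zero, mul_one, add_zero, mul_neg, neg_zero]
      have ih1 := ih.1
      rw [← fordInt_neg] at ih1
      exact ⟨ih.1, fordInt_add_mem hα ih1 ih.2 (by
        rw [show -x 0 0 * x 1 1 - x 0 1 * -x 1 0 = -1 by linear_combination -hdet]; rfl)⟩

theorem fordInt_mem {α : ℝ} (hα : 0 < α) {m n : ℤ} (h : IsCoprime m n) :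
    fordInt α m n ∈ orbit (baseQuad α) := by
  obtain ⟨a, b, hab⟩ := h
  let g : Matrix.SpecialLinearGroup (Fin 2) ℤ :=
    ⟨!![m, -b; n, a], by rw [Matrix.det_fin_two_of]; linear_combination hab⟩
  exact (fordInt_columns_mem hα g).1

/-! ### Similarities preserving the `x`-axis -/

/-- The similarity `(x, y) ↦ (ε μ x + c, δ μ y + d)`. -/
noncomputable def axialSimilarity (ε δ μ c d : ℝ) (hε : ε ^ 2 = 1) (hδ : δ ^ 2 = 1) (hμ : 0 < μ) :
    Similarity where
  toFun p := !₂[ε * μ * p 0 + c, δ * μ * p 1 + d]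
  invFun p := !₂[ε / μ * (p 0 - c), δ / μ * (p 1 - d)]
  left_inv p := by
    apply plane_ext
    · simp
      field_simp
      rw [hε, one_mul]
    · simp
      field_simp
      rw [hδ, one_mul]
  right_inv p := by
    apply plane_ext
    · simp
      field_simp
      rw [hε]
      ring
    · simp
      field_simp
      rw [hδ]
      ring
  edist_eq' := by
    refine ⟨⟨μ, hμ.le⟩, fun h => hμ.ne' (congrArg NNReal.toReal h), fun p q => ?_⟩
    have : dist (!₂[ε * μ * p 0 + c, δ * μ * p 1 + d] : Plane)
        !₂[ε * μ * q 0 + c, δ * μ * q 1 + d] = μ * dist p q := by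
      rw [← sq_eq_sq₀ dist_nonneg (by positivity), mul_pow, dist_sq, dist_sq]
      simp
      linear_combination μ ^ 2 * (p 0 - q 0) ^ 2 * hε + μ ^ 2 * (p 1 - q 1) ^ 2 * hδ
    rw [edist_dist, edist_dist]
    change ENNReal.ofReal (dist (!₂[ε * μ * p 0 + c, δ * μ * p 1 + d] : Plane)
        !₂[ε * μ * q 0 + c, δ * μ * q 1 + d]) = _
    rw [this, ENNReal.ofReal_mul hμ.le]
    congr 1
    rw [ENNReal.ofReal, Real.toNNReal_of_nonneg hμ.le]
    rfl

theorem axialSimilarity_apply {ε δ μ c d : ℝ} (hε : ε ^ 2 = 1) (hδ : δ ^ 2 = 1) (hμ : 0 < μ)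
    (p : Plane) : axialSimilarity ε δ μ c d hε hδ hμ p = !₂[ε * μ * p 0 + c, δ * μ * p 1 + d] :=
  rfl

/-- Identifies the coordinates of an image circle from a pulled-back equation alone, treating lines
and round circles alike. -/
theorem vec_map_eq {Φ : Similarity} {C : PlaneCircle} {w : Vec} {k : ℝ} (hw : ip w w = 1)
    (hk : 0 < k) (h : ∀ p, powerAt w (Φ p) = k * powerAt C.vec p) : (C.map Φ).vec = w := by
  refine Represents.vec ⟨hw, ?_, ?_⟩
  · change Φ '' C.curve = _
    rw [C.represents.curve_eq, image_eq_setOf]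
    ext p
    simp only [Set.mem_ofPred_eq]
    conv_rhs => rw [← Φ.apply_symm_apply p, h]
    simp [hk.ne']
  · change Φ '' C.interior = _
    rw [C.represents.interior_eq, image_eq_setOf]
    ext p
    simp only [Set.mem_ofPred_eq]
    conv_rhs => rw [← Φ.apply_symm_apply p, h]
    constructor
    · exact fun h => mul_neg_of_pos_of_neg hk h
    · intro h
      by_contra h'
      exact absurd h (not_lt.2 (mul_nonneg hk.le (not_lt.1 h')))

theorem powerAt_axisVec (p : Plane) : powerAt axisVec p = 2 * p 1 := by
  simp [powerAt, axisVec]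

/-- The similarity is `(x, y) ↦ (ε x / l² + c, y / l²)`. -/
structure HasAxialForm (Φ : Similarity) (ε l c : ℝ) : Prop where
  sq_eq : ε ^ 2 = 1
  pos : 0 < l
  apply_zero : ∀ p, Φ p 0 = ε / l ^ 2 * p 0 + c
  apply_one : ∀ p, Φ p 1 = p 1 / l ^ 2

theorem exists_hasAxialForm {ε l : ℝ} (c : ℝ) (hε : ε ^ 2 = 1) (hl : 0 < l) :
    ∃ Φ : Similarity, HasAxialForm Φ ε l c := by
  refine ⟨axialSimilarity ε 1 (1 / l ^ 2) c 0 hε (by norm_num) (by positivity), hε, hl, ?_, ?_⟩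
  · intro p
    simp [axialSimilarity_apply, div_eq_mul_inv]
  · intro p
    simp [axialSimilarity_apply, div_eq_inv_mul]

theorem ratio_pos' (Φ : Similarity) : (0 : ℝ) < Dilation.ratio Φ := by
  exact_mod_cast Dilation.ratio_pos Φ

theorem dist_apply_sq (Φ : Similarity) (x y : Plane) :
    (Φ x 0 - Φ y 0) ^ 2 + (Φ x 1 - Φ y 1) ^ 2 =
      (Dilation.ratio Φ : ℝ) ^ 2 * ((x 0 - y 0) ^ 2 + (x 1 - y 1) ^ 2) := by
  rw [← dist_sq, ← dist_sq, dist_apply, mul_pow]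

/-- The images of (0, 0) and (1, 0) lie on the axis. Distances to them determine the first
coordinate and, up to sign, the second; preservation of the lower half-plane fixes that sign. -/
theorem hasAxialForm_of_map_xAxis {Φ : Similarity} (h : xAxis.map Φ = xAxis) :
    ∃ ε l c : ℝ, HasAxialForm Φ ε l c := by
  have hax := xAxis.represents
  rw [vec_xAxis] at hax
  have hcurve : ∀ p, p 1 = 0 → Φ p 1 = 0 := by
    intro p hp
    have : Φ p ∈ (xAxis.map Φ).curve :=
      ⟨p, (hax.mem_curve p).2 (by rw [powerAt_axisVec, hp, mul_zero]), rfl⟩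
    rw [h, hax.mem_curve, powerAt_axisVec] at this
    linarith
  have hint : ∀ p, Φ p 1 < 0 ↔ p 1 < 0 := by
    intro p
    have h1 : Φ p ∈ (xAxis.map Φ).interior ↔ p ∈ xAxis.interior :=
      Φ.injective.mem_set_image
    rw [h, hax.mem_interior, hax.mem_interior, powerAt_axisVec, powerAt_axisVec] at h1
    constructor <;> intro h2
    · linarith [h1.1 (by linarith)]
    · linarith [h1.2 (by linarith)]
  have hμ := ratio_pos' Φ
  obtain ⟨μ, hμdef⟩ : ∃ μ : ℝ, μ = Dilation.ratio Φ := ⟨_, rfl⟩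
  rw [← hμdef] at hμ
  set c := Φ 0 0 with hc
  have h0 : Φ 0 1 = 0 := hcurve 0 rfl
  have h1 : Φ !₂[1, 0] 1 = 0 := hcurve _ rfl
  have hd := dist_apply_sq Φ !₂[1, 0] 0
  rw [← hμdef, ← hc, h0, h1] at hd
  simp at hd
  set ε := (Φ !₂[1, 0] 0 - c) / μ with hε
  have hεμ : Φ !₂[1, 0] 0 = c + ε * μ := by rw [hε]; field_simp; ring
  have hε2 : ε ^ 2 = 1 := by
    rw [hεμ] at hd
    have : μ ^ 2 * ε ^ 2 = μ ^ 2 * 1 := by linear_combination hd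
    exact mul_left_cancel₀ (by positivity) this
  have hsq : (1 / Real.sqrt μ) ^ 2 = 1 / μ := by
    rw [div_pow, Real.sq_sqrt hμ.le, one_pow]
  have hx : ∀ p, Φ p 0 = ε * μ * p 0 + c := by
    intro p
    have e0 := dist_apply_sq Φ p 0
    have e1 := dist_apply_sq Φ p !₂[1, 0]
    rw [h0, ← hc, ← hμdef] at e0
    rw [h1, hεμ, ← hμdef] at e1
    simp at e0 e1
    have : μ * (Φ p 0) = μ * (ε * μ * p 0 + c) := by
      linear_combination ε / 2 * (e0 - e1) + (-μ * Φ p 0 + μ * c + μ ^ 2 * ε / 2) * hε2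
    exact mul_left_cancel₀ hμ.ne' this
  refine ⟨ε, 1 / Real.sqrt μ, c, hε2, by positivity, fun p => ?_, fun p => ?_⟩
  · rw [hx, hsq, div_div_eq_mul_div, div_one]
  · rw [hsq, div_div_eq_mul_div, div_one]
    have e0 := dist_apply_sq Φ p 0
    rw [h0, ← hc, ← hμdef, hx] at e0
    simp at e0
    have e2 : (Φ p 1) ^ 2 = (p 1 * μ) ^ 2 := by
      linear_combination e0 - μ ^ 2 * p 0 ^ 2 * hε2
    rcases sq_eq_sq_iff_eq_or_eq_neg.1 e2 with e | e
    · exact e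
    · rcases lt_trichotomy (p 1) 0 with hp | hp | hp
      · have := (hint p).2 hp
        nlinarith
      · rw [e, hp]; ring
      · have : Φ p 1 < 0 := by rw [e]; nlinarith
        linarith [(hint p).1 this]

theorem HasAxialForm.map_xAxis {Φ : Similarity} {ε l c : ℝ} (h : HasAxialForm Φ ε l c) :
    xAxis.map Φ = xAxis := by
  apply vec_injective
  rw [vec_xAxis]
  have hl := h.pos
  refine vec_map_eq (k := 1 / l ^ 2) ip_axisVec_self (by positivity) fun p => ?_
  rw [vec_xAxis, powerAt_axisVec, powerAt_axisVec, h.apply_one]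
  ring

theorem ip_fordVec_self (t s : ℝ) : ip (fordVec t s) (fordVec t s) = 1 := by
  rw [ip_fordVec]; ring

/-- The action on (t, s) is linear and triangular with diagonal ε/l, l, hence of determinant ε. This
is why ratios are written as 1/l². -/
theorem HasAxialForm.vec_map {Φ : Similarity} {ε l c : ℝ} (h : HasAxialForm Φ ε l c)
    {C : PlaneCircle} {t s : ℝ} (hC : C.vec = fordVec t s) :
    (C.map Φ).vec = fordVec (ε * t / l + l * c * s / 2) (l * s) := by
  have hl := h.pos
  refine vec_map_eq (k := 1 / l ^ 2) (ip_fordVec_self _ _) (by positivity) fun p => ?_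
  rw [hC]
  simp only [powerAt, h.apply_zero, h.apply_one]
  simp [fordVec]
  field_simp
  linear_combination (4 * s ^ 2 * p 0 ^ 2 - 16 * t * s * p 0 + 16 * t ^ 2) * h.sq_eq

theorem HasAxialForm.ratio {Φ : Similarity} {ε l c : ℝ} (h : HasAxialForm Φ ε l c) :
    (Dilation.ratio Φ : ℝ) = 1 / l ^ 2 := by
  have hl := h.pos
  have e := dist_apply_sq Φ !₂[0, 1] 0
  rw [h.apply_zero, h.apply_zero, h.apply_one, h.apply_one] at e
  simp at e
  have : (Dilation.ratio Φ : ℝ) ^ 2 = (1 / l ^ 2) ^ 2 := by rw [← e]; ring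
  exact (sq_eq_sq₀ (ratio_pos' Φ).le (by positivity)).1 this

theorem HasAxialForm.eq_one {Φ : Similarity} (h : HasAxialForm Φ 1 1 0) : Φ = 1 := by
  ext p : 1
  apply plane_ext
  · rw [h.apply_zero]; simp
  · rw [h.apply_one]; simp

/-! ### Orientation -/

/-- The linear part is diagonal with signs ε and δ, so its determinant is εδ. -/
theorem mem_orientationPreserving_iff {Φ : Similarity} {μ ε δ c d : ℝ} (hμ : 0 < μ)
    (hε : ε ^ 2 = 1) (hδ : δ ^ 2 = 1) (h0 : ∀ p, Φ p 0 = ε * μ * p 0 + c)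
    (h1 : ∀ p, Φ p 1 = δ * μ * p 1 + d) : Φ ∈ orientationPreserving ↔ ε = δ := by
  constructor
  · rintro ⟨ν, A, b, hν, hA, h⟩
    have hA0 : ∀ p, ν * A p 0 = ε * μ * p 0 := by
      intro p
      have e1 := congrArg (fun x : Plane => x 0) (h p)
      have e2 := congrArg (fun x : Plane => x 0) (h 0)
      simp [h0] at e1 e2
      linarith
    have hA1 : ∀ p, ν * A p 1 = δ * μ * p 1 := by
      intro p
      have e1 := congrArg (fun x : Plane => x 1) (h p)
      have e2 := congrArg (fun x : Plane => x 1) (h 0)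
      simp [h1] at e1 e2
      linarith
    rw [← LinearMap.det_toMatrix (EuclideanSpace.basisFun (Fin 2) ℝ).toBasis,
      Matrix.det_fin_two] at hA
    simp [LinearMap.toMatrix_apply] at hA
    have a00 := hA0 (EuclideanSpace.single 0 1)
    have a01 := hA0 (EuclideanSpace.single 1 1)
    have a11 := hA1 (EuclideanSpace.single 1 1)
    simp at a00 a01 a11
    have a01' := a01.resolve_left hν.ne'
    rw [a01', zero_mul, sub_zero] at hA
    have hdet : ν ^ 2 = ε * δ * μ ^ 2 := by
      linear_combination (-ν ^ 2) * hA + ν * (A (EuclideanSpace.single 1 1) 1) * a00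
        + ε * μ * a11
    have hs : 0 < ε * δ := by
      by_contra hn
      have : ε * δ * μ ^ 2 ≤ 0 := mul_nonpos_of_nonpos_of_nonneg (not_lt.1 hn) (by positivity)
      nlinarith [pow_pos hν 2]
    rcases sq_eq_sq_iff_eq_or_eq_neg.1 (hε.trans hδ.symm) with e | e
    · exact e
    · rw [e] at hs
      nlinarith [sq_nonneg δ]
  · rintro rfl
    rcases sq_eq_one_iff.1 hε with rfl | rfl
    · refine ⟨μ, LinearIsometryEquiv.refl ℝ Plane, !₂[c, d], hμ, LinearMap.det_id, fun p => ?_⟩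
      apply plane_ext
      · rw [h0]; simp
      · rw [h1]; simp
    · refine ⟨μ, LinearIsometryEquiv.neg ℝ, !₂[c, d], hμ, ?_, fun p => ?_⟩
      · have : ((LinearIsometryEquiv.neg ℝ : Plane ≃ₗᵢ[ℝ] Plane).toLinearEquiv : Plane →ₗ[ℝ] Plane)
            = (-1 : ℝ) • LinearMap.id := by
          ext p
          simp
        rw [this, LinearMap.det_smul, LinearMap.det_id]
        simp
      · apply plane_ext
        · rw [h0]; simp
        · rw [h1]; simp

theorem HasAxialForm.mem_orientationPreserving_iff {Φ : Similarity} {ε l c : ℝ}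
    (h : HasAxialForm Φ ε l c) : Φ ∈ orientationPreserving ↔ ε = 1 := by
  have hl := h.pos
  refine Apollonian.mem_orientationPreserving_iff (μ := 1 / l ^ 2) (c := c) (d := 0)
    (by positivity) h.sq_eq (one_pow 2) (fun p => ?_) fun p => ?_
  · rw [h.apply_zero]; ring
  · rw [h.apply_one]; ring

/-! ### Symmetries and integer matrices -/

theorem mem_orbitCircles {q : Fin 4 → Vec} {C : PlaneCircle} :
    C ∈ orbitCircles q ↔ C.vec ∈ orbit q := Iff.rfl

theorem eq_or_eq_neg_of_fordVec_eq {t s t' s' : ℝ} (hs : s ≠ 0)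
    (h : fordVec t s = fordVec t' s') : (t' = t ∧ s' = s) ∨ (t' = -t ∧ s' = -s) := by
  have h0 : s ^ 2 = s' ^ 2 := by simpa [fordVec] using congrFun h 0
  have h2 : 2 * t * s = 2 * t' * s' := by simpa [fordVec] using congrFun h 2
  rcases sq_eq_sq_iff_eq_or_eq_neg.1 h0.symm with e | e
  · left
    refine ⟨?_, e⟩
    rw [e] at h2
    linarith [mul_right_cancel₀ hs h2]
  · right
    refine ⟨?_, e⟩
    have : 2 * t * s = -2 * t' * s := by rw [h2, e]; ring
    linarith [mul_right_cancel₀ hs this]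

/-- Every line of the packing other than the `x`-axis is a Ford circle with curvature zero. -/
theorem eq_axisVec_or_exists {α : ℝ} (hα : 0 < α) {w : Vec} (hw : w ∈ orbit (baseQuad α))
    (h0 : w 0 = 0) :
    w = axisVec ∨ ∃ m n : ℤ, IsCoprime m n ∧ w = fordInt α m n ∧ m * α + n = 0 := by
  have hbase : baseQuad α 2 = axisVec := rfl
  rcases ip_orbit_of_base (isDescartes_baseQuad hα) 2 hw with h | h
  · exact Or.inl h
  · right
    rw [hbase] at h
    have h1 := ip_self_of_mem_orbit (isDescartes_baseQuad hα) hw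
    have h3 : ip axisVec w = -w 3 := by simp [ip, axisVec, h0]
    -- The normal is a unit vector, so `w 3` ≤ 1, while the inner product −`w 3` with the axis is at
    -- most −1.
    have h4 : w 3 = 1 := by
      simp only [ip, h0] at h1
      nlinarith [sq_nonneg (w 2)]
    obtain ⟨m, n, hmn, rfl⟩ := exists_eq_fordInt hα hw (by rw [h3, h4])
    refine ⟨m, n, hmn, rfl, ?_⟩
    simpa [fordInt, fordVec] using h0

theorem exists_rat_of_relation {α : ℝ} {m n : ℤ} (h : m * α + n = 0) (hm : m ≠ 0) :
    ∃ q : ℚ, (q : ℝ) = α := by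
  refine ⟨-n / m, ?_⟩
  have : (m : ℝ) ≠ 0 := by exact_mod_cast hm
  push_cast
  field_simp
  linarith

theorem eq_zero_of_relation {α : ℝ} (hirr : ¬ ∃ q : ℚ, (q : ℝ) = α) {m n : ℤ}
    (h : m * α + n = 0) : m = 0 ∧ n = 0 := by
  have hm : m = 0 := by
    by_contra hm
    exact hirr (exists_rat_of_relation h hm)
  refine ⟨hm, ?_⟩
  rw [hm] at h
  simpa using h

/-- Similarities map lines to lines, and for irrational α the axis is the only line of the packing.
-/
theorem map_xAxis_of_mem_symm {α : ℝ} (hα : 0 < α) (hirr : ¬ ∃ q : ℚ, (q : ℝ) = α)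
    {Φ : Similarity} (hΦ : Φ ∈ Symm (packing α hα)) : xAxis.map Φ = xAxis := by
  rw [packing_eq] at hΦ
  have hx : xAxis ∈ orbitCircles (baseQuad α) := by
    rw [mem_orbitCircles]
    rw [vec_xAxis]
    exact axisVec_mem α
  have hmem : (xAxis.map Φ).vec ∈ orbit (baseQuad α) := map_mem_of_mem_symm hΦ hx
  have hline : (xAxis.map Φ).vec 0 = 0 := by
    rw [← isLine_iff, isLine_map, isLine_iff, vec_xAxis]
    rfl
  apply vec_injective
  rw [vec_xAxis]
  rcases eq_axisVec_or_exists hα hmem hline with h | ⟨m, n, hmn, -, h⟩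
  · exact h
  · obtain ⟨rfl, rfl⟩ := eq_zero_of_relation hirr h
    exact absurd (isCoprime_zero_left.1 hmn) not_isUnit_zero

/-- The image of a Ford circle under a symmetry fixing the `x`-axis. -/
theorem HasAxialForm.exists_image {α : ℝ} (hα : 0 < α) {Φ : Similarity} {ε l c : ℝ}
    (h : HasAxialForm Φ ε l c) (hΦ : Φ ∈ Symm (packing α hα)) {m n : ℤ}
    (hmn : IsCoprime m n) (hs : m * α + n ≠ 0) :
    ∃ m' n' : ℤ, n' / α = ε * (n / α) / l + l * c * (m * α + n) / 2 ∧
      m' * α + n' = l * (m * α + n) := by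
  rw [packing_eq] at hΦ
  obtain ⟨C, hC⟩ := exists_vec_eq (w := fordInt α m n) (ip_fordVec_self _ _)
  have hmem : C ∈ orbitCircles (baseQuad α) := by
    rw [mem_orbitCircles]
    rw [hC]
    exact fordInt_mem hα hmn
  have hmem' : (C.map Φ).vec ∈ orbit (baseQuad α) := map_mem_of_mem_symm hΦ hmem
  rw [h.vec_map hC] at hmem'
  obtain ⟨m', n', -, he⟩ := exists_eq_fordInt hα hmem' (ip_axisVec_fordVec _ _)
  rcases eq_or_eq_neg_of_fordVec_eq (mul_ne_zero h.pos.ne' hs) he with ⟨h1, h2⟩ | ⟨h1, h2⟩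
  · exact ⟨m', n', h1, h2⟩
  · refine ⟨-m', -n', ?_, ?_⟩
    · push_cast; rw [neg_div, h1, neg_neg]
    · push_cast; linarith

/-- The action of a similarity fixing the `x`-axis on the indices of the Ford circles is given by
the integer matrix with rows `(m, n)` and `(m', n')`, which has `(α, 1)` as an eigenvector. -/
structure HasMatrix (α ε l c : ℝ) (m n m' n' : ℤ) : Prop where
  row : m * α + n = l * α
  row' : m' * α + n' = l
  det : ((m * n' - n * m' : ℤ) : ℝ) = ε
  shift : n / α = l * c * α / 2

/-- The rows are the indices of the images of the generating circles (1, 0) and (0, 1). -/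
theorem HasAxialForm.exists_hasMatrix {α : ℝ} (hα : 0 < α) {Φ : Similarity} {ε l c : ℝ}
    (h : HasAxialForm Φ ε l c) (hΦ : Φ ∈ Symm (packing α hα)) :
    ∃ m n m' n' : ℤ, HasMatrix α ε l c m n m' n' := by
  obtain ⟨m, n, h1, h2⟩ := h.exists_image hα hΦ (m := 1) (n := 0) isCoprime_one_left
    (by simpa using hα.ne')
  obtain ⟨m', n', h3, h4⟩ := h.exists_image hα hΦ (m := 0) (n := 1) isCoprime_one_right
    (by simp)
  push_cast at h1 h2 h3 h4
  rw [zero_div, mul_zero, zero_div, zero_add, one_mul, add_zero] at h1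
  rw [one_mul, add_zero] at h2
  rw [zero_mul, zero_add, mul_one] at h3 h4
  have hl := h.pos
  refine ⟨m, n, m', n', h2, h4, ?_, h1⟩
  have e : (m * n' - n * m' : ℝ) = n' / α * (m * α + n) - n / α * (m' * α + n') := by
    field_simp
    ring
  push_cast
  rw [e, h1, h2, h3, h4]
  field_simp
  ring

theorem HasMatrix.exists_mem_symm {α : ℝ} (hα : 0 < α) {ε l : ℝ} {m n m' n' : ℤ}
    (hε : ε ^ 2 = 1) (hl : 0 < l) (h1 : m * α + n = l * α) (h2 : m' * α + n' = l)
    (hdet : ((m * n' - n * m' : ℤ) : ℝ) = ε) :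
    ∃ (Φ : Similarity) (c : ℝ), HasAxialForm Φ ε l c ∧ Φ ∈ Symm (packing α hα) := by
  -- The translation part is the one forced by `HasMatrix.shift`.
  obtain ⟨Φ, hΦ⟩ := exists_hasAxialForm (2 * n / (l * α ^ 2)) hε hl
  refine ⟨Φ, _, hΦ, ?_⟩
  have hq := isDescartes_baseQuad hα
  have hZ := future_baseQuad hα
  have hdet2 : (m * n' - n * m') ^ 2 = 1 := by
    have : ((m * n' - n * m' : ℤ) : ℝ) ^ 2 = 1 := by rw [hdet, hε]
    exact_mod_cast this
  rw [packing_eq]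
  obtain ⟨A, hA⟩ := exists_vec_eq (hq.self 0)
  obtain ⟨B, hB⟩ := exists_vec_eq (hq.self 1)
  have hA' : A ∈ orbitCircles (baseQuad α) := by
    rw [mem_orbitCircles]
    rw [hA]
    exact mem_orbit_self _ 0
  have hB' : B ∈ orbitCircles (baseQuad α) := by
    rw [mem_orbitCircles]
    rw [hB]
    exact mem_orbit_self _ 1
  have hx : xAxis ∈ orbitCircles (baseQuad α) := by
    rw [mem_orbitCircles]
    rw [vec_xAxis]
    exact axisVec_mem α
  have hxv : xAxis.vec = baseQuad α 2 := vec_xAxis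
  refine mem_symm_of_triple hq hZ (A := A) (B := B) (C := xAxis) ⟨?_, ?_, ?_⟩ hA' hB' hx ?_ ?_ ?_
  · exact extTangent_of_mem_orbit hq hZ hA' hB' (by rw [hA, hB]; exact hq.ne (by decide))
  · exact extTangent_of_mem_orbit hq hZ hB' hx (by rw [hB, hxv]; exact hq.ne (by decide))
  · exact extTangent_of_mem_orbit hq hZ hA' hx (by rw [hA, hxv]; exact hq.ne (by decide))
  · rw [mem_orbitCircles]
    rw [hΦ.vec_map (C := A) (t := ((0 : ℤ) : ℝ) / α) (s := ((1 : ℤ) : ℝ) * α + ((0 : ℤ) : ℝ)) hA]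
    convert fordInt_mem hα (m := m) (n := n) ?_ using 1
    · rw [fordInt, h1]
      congr 1
      · push_cast; field_simp; ring
      · push_cast; ring
    · exact ⟨(m * n' - n * m') * n', -(m * n' - n * m') * m', by linear_combination hdet2⟩
  · rw [mem_orbitCircles]
    rw [hΦ.vec_map (C := B) (t := ((1 : ℤ) : ℝ) / α) (s := ((0 : ℤ) : ℝ) * α + ((1 : ℤ) : ℝ)) hB]
    convert fordInt_mem hα (m := m') (n := n') ?_ using 1
    · rw [fordInt, h2]
      congr 1
      · push_cast
        field_simp
        rw [← hdet]
        push_cast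
        linear_combination (n' : ℝ) * h1 - n * h2
      · push_cast; ring
    · exact ⟨-(m * n' - n * m') * n, (m * n' - n * m') * m, by linear_combination hdet2⟩
  · rw [hΦ.map_xAxis]
    exact hx

theorem eq_one_of_hasMatrix {α : ℝ} (hα : 0 < α) {Φ : Similarity} {ε l c : ℝ} {m n m' n' : ℤ}
    (h : HasAxialForm Φ ε l c) (hM : HasMatrix α ε l c m n m' n') (hn : n = 0) (hm : m' = 0)
    (hmn : m = n') : Φ = 1 ∧ ε = 1 := by
  subst hn hm hmn
  have h2 := hM.row'
  have h3 := hM.det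
  have h4 := hM.shift
  have hl := h.pos
  push_cast at h2 h3 h4
  rw [zero_mul, zero_add] at h2
  have hε : ε = l ^ 2 := by rw [← h3, ← h2]; ring
  have hl1 : l = 1 := by
    have := h.sq_eq
    rw [hε] at this
    nlinarith [sq_nonneg (l ^ 2 - 1), sq_nonneg (l - 1), pow_pos hl 2]
  subst hl1
  have hε1 : ε = 1 := by rw [hε]; norm_num
  subst hε1
  have hc : c = 0 := by
    have : c * α = 0 := by
      rw [zero_div] at h4
      linarith
    exact (mul_eq_zero.1 this).resolve_right hα.ne'
  subst hc
  exact ⟨h.eq_one, rfl⟩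

theorem exists_form_of_mem_symm {α : ℝ} (hα : 0 < α) (hirr : ¬ ∃ q : ℚ, (q : ℝ) = α)
    {Φ : Similarity} (hΦ : Φ ∈ Symm (packing α hα)) :
    ∃ (ε l c : ℝ) (m n m' n' : ℤ), HasAxialForm Φ ε l c ∧ HasMatrix α ε l c m n m' n' := by
  obtain ⟨ε, l, c, h⟩ := hasAxialForm_of_map_xAxis (map_xAxis_of_mem_symm hα hirr hΦ)
  obtain ⟨m, n, m', n', hM⟩ := h.exists_hasMatrix hα hΦ
  exact ⟨ε, l, c, m, n, m', n', h, hM⟩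

/-- The quadratic relation given by an eigenvector. -/
theorem HasMatrix.relation {α ε l c : ℝ} {m n m' n' : ℤ} (h : HasMatrix α ε l c m n m' n') :
    m' * α ^ 2 + (n' - m : ℤ) * α + (-n : ℤ) = 0 := by
  push_cast
  linear_combination α * h.row' - h.row

/-! ### Irrational parameters -/

theorem HasAxialForm.mul {Φ Ψ : Similarity} {ε l c ε' l' c' : ℝ} (h : HasAxialForm Φ ε l c)
    (h' : HasAxialForm Ψ ε' l' c') :
    HasAxialForm (Φ * Ψ) (ε * ε') (l * l') (ε / l ^ 2 * c' + c) where
  sq_eq := by rw [mul_pow, h.sq_eq, h'.sq_eq, one_mul]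
  pos := mul_pos h.pos h'.pos
  apply_zero p := by
    have hl := h.pos
    have hl' := h'.pos
    change Φ (Ψ p) 0 = _
    rw [h.apply_zero, h'.apply_zero]
    field_simp
    ring
  apply_one p := by
    have hl := h.pos
    have hl' := h'.pos
    change Φ (Ψ p) 1 = _
    rw [h.apply_one, h'.apply_one]
    field_simp

/-- The characteristic polynomial of the integer matrix vanishes at the eigenvalue. -/
theorem HasMatrix.charpoly {α ε l c : ℝ} (hα : 0 < α) {m n m' n' : ℤ}
    (h : HasMatrix α ε l c m n m' n') : ((m + n' : ℤ) : ℝ) * l = l ^ 2 + ε := by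
  have h1 := h.row
  have h2 := h.row'
  have h3 := h.det
  push_cast at h3 ⊢
  have : α * ((m + n') * l) = α * (l ^ 2 + ε) := by
    linear_combination α * h3 + (l - n') * h1 + n * h2
  exact mul_left_cancel₀ hα.ne' this

/-- The trace l + ε/l is an integer. For ε = 1 it exceeds 2, hence is at least 3; for ε = −1 it is
at least 1, so l is at least the golden ratio. The value 3/2 is a convenient smaller bound. -/
theorem HasMatrix.gap {α ε l c : ℝ} (hα : 0 < α) {m n m' n' : ℤ}
    (h : HasMatrix α ε l c m n m' n') (hε : ε ^ 2 = 1) (hl : 1 < l) : 3 / 2 ≤ l := by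
  have hc := h.charpoly hα
  by_contra hlt
  rw [not_le] at hlt
  rcases sq_eq_one_iff.1 hε with rfl | rfl
  · have h2 : (2 : ℝ) < (m + n' : ℤ) := by nlinarith [sq_pos_of_pos (sub_pos.2 hl)]
    have h3 : (3 : ℤ) ≤ m + n' := by exact_mod_cast h2
    have h4 : (3 : ℝ) ≤ (m + n' : ℤ) := by exact_mod_cast h3
    nlinarith
  · have h2 : (0 : ℝ) < (m + n' : ℤ) := by nlinarith
    have h3 : (1 : ℤ) ≤ m + n' := by exact_mod_cast h2
    have h4 : (1 : ℝ) ≤ (m + n' : ℤ) := by exact_mod_cast h3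
    nlinarith

/-- An integer matrix fixing (α, 1) with α irrational is the identity. -/
theorem eq_one_of_eigenvalue_one {α : ℝ} (hα : 0 < α) (hirr : ¬ ∃ q : ℚ, (q : ℝ) = α)
    {Φ : Similarity} {ε c : ℝ} {m n m' n' : ℤ} (h : HasAxialForm Φ ε 1 c)
    (hM : HasMatrix α ε 1 c m n m' n') : Φ = 1 := by
  have h1 := hM.row
  have h2 := hM.row'
  obtain ⟨a, b⟩ := eq_zero_of_relation hirr (m := m') (n := n' - 1) (by push_cast; linarith)
  obtain ⟨d, e⟩ := eq_zero_of_relation hirr (m := m - 1) (n := n) (by push_cast; linarith)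
  exact (eq_one_of_hasMatrix hα h hM e a (by omega)).1

/-- A group that embeds as a discrete nontrivial subgroup of `ℝ` is infinite cyclic. -/
theorem nonempty_mulEquiv_int {G : Type*} [Group G] (f : G →* Multiplicative ℝ)
    (hf : Function.Injective f) {a : ℝ} (ha : 0 < a)
    (hgap : ∀ g, ¬ (0 < (f g).toAdd ∧ (f g).toAdd < a)) (hne : ∃ g : G, g ≠ 1) :
    Nonempty (G ≃* Multiplicative ℤ) := by
  obtain ⟨b, hb⟩ := Subgroup.cyclic_of_isolated_one (H := f.range) (a := Multiplicative.ofAdd a)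
    ha (Set.disjoint_left.2 (by
      rintro _ ⟨g, rfl⟩ ⟨h1, h2⟩
      exact hgap g ⟨h1, h2⟩))
  rw [← Subgroup.zpowers_eq_closure] at hb
  obtain ⟨g, rfl⟩ : b ∈ f.range := by rw [hb]; exact Subgroup.mem_zpowers b
  have htop : Subgroup.zpowers g = ⊤ := by
    rw [eq_top_iff]
    intro x _
    have hx : f x ∈ f.range := ⟨x, rfl⟩
    rw [hb] at hx
    obtain ⟨n, hn⟩ := hx
    exact ⟨n, hf (by rw [← hn]; exact map_zpow f g n)⟩
  have hg : g ≠ 1 := by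
    rintro rfl
    obtain ⟨x, hx⟩ := hne
    have : x ∈ Subgroup.zpowers (1 : G) := by rw [htop]; trivial
    rw [Subgroup.zpowers_one_eq_bot, Subgroup.mem_bot] at this
    exact hx this
  have hinf : Infinite G := by
    refine Infinite.of_injective (fun n : ℤ => g ^ n) fun n m hnm => ?_
    have h1 := congrArg (fun x => (f x).toAdd) hnm
    simp only [map_zpow, toAdd_zpow, zsmul_eq_mul] at h1
    have h0 : (f g).toAdd ≠ 0 := by
      intro h0
      apply hg
      apply hf
      rw [map_one]
      exact h0
    exact_mod_cast mul_right_cancel₀ h0 h1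
  exact ⟨(intEquivOfZPowersEqTop g htop).symm⟩

/-- The logarithm of the ratio of a similarity. -/
noncomputable def logRatio : Similarity →* Multiplicative ℝ where
  toFun Φ := Multiplicative.ofAdd (Real.log (Dilation.ratio Φ))
  map_one' := by
    rw [show (Dilation.ratio (1 : Similarity)) = 1 from map_one DilationEquiv.ratioHom]
    simp
  map_mul' Φ Ψ := by
    rw [show Dilation.ratio (Φ * Ψ) = Dilation.ratio Φ * Dilation.ratio Ψ from
      map_mul DilationEquiv.ratioHom Φ Ψ, NNReal.coe_mul,
      Real.log_mul (ratio_pos' Φ).ne' (ratio_pos' Ψ).ne']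
    rfl

theorem HasAxialForm.logRatio_eq {Φ : Similarity} {ε l c : ℝ} (h : HasAxialForm Φ ε l c) :
    (logRatio Φ).toAdd = -(2 * Real.log l) := by
  change Real.log (Dilation.ratio Φ) = _
  rw [h.ratio, one_div, Real.log_inv, Real.log_pow]
  norm_num

theorem nonempty_symm_mulEquiv_int {α : ℝ} (hα : 0 < α) (hirr : ¬ ∃ q : ℚ, (q : ℝ) = α)
    (hne : ∃ Φ ∈ Symm (packing α hα), Φ ≠ 1) :
    Nonempty (Symm (packing α hα) ≃* Multiplicative ℤ) := by
  refine nonempty_mulEquiv_int (logRatio.comp (Symm (packing α hα)).subtype) ?_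
    (a := 2 * Real.log (3 / 2)) (mul_pos two_pos (Real.log_pos (by norm_num))) ?_ ?_
  · rw [injective_iff_map_eq_one]
    rintro ⟨Φ, hΦ⟩ h1
    obtain ⟨ε, l, c, m, n, m', n', h, hM⟩ := exists_form_of_mem_symm hα hirr hΦ
    have h2 : (logRatio Φ).toAdd = 0 := h1
    rw [h.logRatio_eq] at h2
    have hl : l = 1 := Real.eq_one_of_pos_of_log_eq_zero h.pos (by linarith)
    subst hl
    exact Subtype.ext (eq_one_of_eigenvalue_one hα hirr h hM)
  · rintro ⟨Φ, hΦ⟩ ⟨h1, h2⟩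
    -- `logRatio` equals −2 log l, so a value of `Φ` between 0 and 2 log(3/2) would give `Φ⁻¹` an
    -- eigenvalue between 1 and 3/2.
    obtain ⟨ε, l, c, m, n, m', n', h, hM⟩ := exists_form_of_mem_symm hα hirr (inv_mem hΦ)
    have h3 : (logRatio Φ⁻¹).toAdd = -(logRatio Φ).toAdd := by rw [map_inv]; rfl
    rw [h.logRatio_eq] at h3
    change 0 < (logRatio Φ).toAdd at h1
    change (logRatio Φ).toAdd < _ at h2
    have h4 : 0 < Real.log l := by linarith
    have h5 : Real.log l < Real.log (3 / 2) := by linarith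
    have h6 : 1 < l := (Real.log_pos_iff h.pos.le).1 h4
    have h7 : l < 3 / 2 := (Real.log_lt_log_iff h.pos (by norm_num)).1 h5
    exact absurd (hM.gap hα h.sq_eq h6) (not_le.2 h7)
  · obtain ⟨Φ, hΦ, h⟩ := hne
    exact ⟨⟨Φ, hΦ⟩, fun h' => h (congrArg Subtype.val h')⟩

/-- Solutions of `x ^ 2 - D y ^ 2 = ± 4` give symmetries. -/
theorem exists_symm_of_solution {α : ℝ} (hα : 0 < α) (hirr : ¬ ∃ q : ℚ, (q : ℝ) = α)
    {a b c x y e : ℤ} (ha : a ≠ 0) (hroot : a * α ^ 2 + b * α + c = 0) (he : e ^ 2 = 1)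
    (hxy : x ^ 2 - (b ^ 2 - 4 * a * c) * y ^ 2 = 4 * e) :
    ∃ (Φ : Similarity) (l d : ℝ), HasAxialForm Φ e l d ∧ Φ ∈ Symm (packing α hα) ∧
      (y ≠ 0 → l ≠ 1) := by
  -- The equation forces x² ≡ b²y² mod 4. The matrix used below has rows (k, −cy) and (ay, k + by),
  -- with trace x, determinant e and eigenvector (α, 1).
  obtain ⟨k, hk⟩ : ∃ k, x - b * y = 2 * k := by
    rcases Int.even_or_odd (x - b * y) with ⟨k, hk⟩ | ⟨k, hk⟩
    · exact ⟨k, by omega⟩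
    · exfalso
      have : 2 * (2 * k * k + 2 * k + (2 * k + 1) * b * y - 2 * e + 2 * a * c * y ^ 2) = -1 := by
        obtain rfl : x = b * y + 2 * k + 1 := by linarith
        linear_combination hxy
      omega
  obtain rfl : x = b * y + 2 * k := by linarith
  have hdet : k * (k + b * y) - (-c * y) * (a * y) = e := by
    have : 4 * (k * (k + b * y) - (-c * y) * (a * y)) = 4 * e := by linear_combination hxy
    omega
  -- The sign `s` makes the eigenvalue positive; an eigenvalue zero would contradict the determinant
  -- ±1.
  have main : ∀ s : ℤ, s ^ 2 = 1 → 0 < s * ((a * y : ℤ) * α + (k + b * y : ℤ)) →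
      ∃ (Φ : Similarity) (l d : ℝ), HasAxialForm Φ e l d ∧ Φ ∈ Symm (packing α hα) ∧
      (y ≠ 0 → l ≠ 1) := by
    intro s hs hpos
    obtain ⟨Φ, d, h1, h2⟩ := HasMatrix.exists_mem_symm hα (ε := e)
      (l := s * ((a * y : ℤ) * α + (k + b * y : ℤ))) (m := s * k) (n := s * (-c * y))
      (m' := s * (a * y)) (n' := s * (k + b * y)) (by exact_mod_cast he) hpos
      (by push_cast; linear_combination (-s * y : ℝ) * hroot) (by push_cast; ring)
      (by
        rw [← hdet]
        have : s * k * (s * (k + b * y)) - s * (-c * y) * (s * (a * y)) =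
          k * (k + b * y) - (-c * y) * (a * y) := by
            linear_combination (k * (k + b * y) - (-c * y) * (a * y)) * hs
        rw [this])
    refine ⟨Φ, _, d, h1, h2, fun hy hl => ?_⟩
    obtain ⟨h3, -⟩ := eq_zero_of_relation hirr (m := s * (a * y)) (n := s * (k + b * y) - 1) (by
      push_cast at hl ⊢
      linear_combination hl)
    rcases mul_eq_zero.1 h3 with h4 | h4
    · rw [h4] at hs
      norm_num at hs
    · exact mul_ne_zero ha hy h4
  rcases lt_trichotomy 0 (((a * y : ℤ) : ℝ) * α + (k + b * y : ℤ)) with h | h | h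
  · exact main 1 (by norm_num) (by simpa using h)
  · exfalso
    obtain ⟨h1, h2⟩ := eq_zero_of_relation hirr h.symm
    rw [h1, h2] at hdet
    simp at hdet
    rw [← hdet] at he
    norm_num at he
  · refine main (-1) (by norm_num) ?_
    push_cast at h ⊢
    linarith

theorem exists_nontrivial_symm {α : ℝ} (hα : 0 < α) (hirr : ¬ ∃ q : ℚ, (q : ℝ) = α)
    {a b c : ℤ} (ha : a ≠ 0) (hroot : a * α ^ 2 + b * α + c = 0) :
    ∃ Φ ∈ Symm (packing α hα), Φ ≠ 1 := by
  have hD : ((b ^ 2 - 4 * a * c : ℤ) : ℝ) = (2 * a * α + b) ^ 2 := by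
    push_cast
    linear_combination (-4 * a : ℝ) * hroot
  have hrel : ∀ k : ℤ, 2 * a * α + b ≠ k := by
    intro k hk
    have := (eq_zero_of_relation hirr (m := 2 * a) (n := b - k) (by push_cast; linarith)).1
    omega
  have hsq : ¬ IsSquare (b ^ 2 - 4 * a * c) := by
    rintro ⟨k, hk⟩
    rw [hk] at hD
    push_cast at hD
    rcases sq_eq_sq_iff_eq_or_eq_neg.1 (show (2 * a * α + b) ^ 2 = (k : ℝ) ^ 2 by
      rw [← hD]; ring) with h | h
    · exact hrel k h
    · exact hrel (-k) (by push_cast; exact h)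
  have hpos : 0 < b ^ 2 - 4 * a * c := by
    have h0 : (2 * a * α + b : ℝ) ≠ 0 := by
      have := hrel 0
      simpa using this
    have : (0 : ℝ) < ((b ^ 2 - 4 * a * c : ℤ) : ℝ) := by rw [hD]; positivity
    exact_mod_cast this
  obtain ⟨x, y, hxy, hy⟩ := Pell.exists_of_not_isSquare hpos hsq
  -- Doubling a solution of Pell's equation x² − Dy² = 1 gives one with right-hand side 4.
  obtain ⟨Φ, l, d, h1, h2, h3⟩ := exists_symm_of_solution hα hirr (x := 2 * x) (y := 2 * y)
    (e := 1) ha hroot (by norm_num) (by linear_combination 4 * hxy)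
  refine ⟨Φ, h2, ?_⟩
  rintro rfl
  have h4 := h1.ratio
  rw [show (Dilation.ratio (1 : Similarity)) = 1 from map_one DilationEquiv.ratioHom] at h4
  have hl := h1.pos
  have h5 : l ^ 2 = 1 := by
    field_simp at h4
    simpa using h4
  exact h3 (by omega) ((sq_eq_one_iff.1 h5).resolve_right (by linarith))

theorem symmPlus_eq_of_forall {P : Set PlaneCircle}
    (h : ∀ Φ ∈ Symm P, Φ ∈ orientationPreserving) : SymmPlus P = Symm P :=
  inf_eq_left.2 h

/-- The sign ε is multiplicative, so one orientation-reversing symmetry already gives index 2. -/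
theorem relIndex_symmPlus {α : ℝ} (hα : 0 < α) (hirr : ¬ ∃ q : ℚ, (q : ℝ) = α)
    {Φ : Similarity} {l d : ℝ} (h : HasAxialForm Φ (-1) l d) (hΦ : Φ ∈ Symm (packing α hα)) :
    (SymmPlus (packing α hα)).relIndex (Symm (packing α hα)) = 2 := by
  refine Subgroup.relIndex_eq_two_iff.2 ⟨Φ, hΦ, fun Ψ hΨ => ?_⟩
  obtain ⟨ε, l', c', m, n, m', n', h', -⟩ := exists_form_of_mem_symm hα hirr hΨ
  have h1 : Ψ ∈ SymmPlus (packing α hα) ↔ ε = 1 := by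
    rw [SymmPlus, Subgroup.mem_inf, h'.mem_orientationPreserving_iff]
    exact and_iff_right hΨ
  have h2 : Ψ * Φ ∈ SymmPlus (packing α hα) ↔ ε * -1 = 1 := by
    rw [SymmPlus, Subgroup.mem_inf, (h'.mul h).mem_orientationPreserving_iff]
    exact and_iff_right (mul_mem hΨ hΦ)
  rw [h1, h2]
  rcases sq_eq_one_iff.1 h'.sq_eq with rfl | rfl
  · right; norm_num
  · left; norm_num

/-! ### Integral quadratic relations and the degree of α -/

/-- An integral relation is an integral multiple of the primitive one. -/
theorem exists_multiple_of_isPrimitive {α : ℝ} (hirr : ¬ ∃ q : ℚ, (q : ℝ) = α)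
    {f : Polynomial ℤ} (hf : f.IsPrimitive) (hdeg : f.natDegree = 2)
    (hroot : f.coeff 2 * α ^ 2 + f.coeff 1 * α + f.coeff 0 = 0) {u v w : ℤ}
    (h : u * α ^ 2 + v * α + w = 0) :
    ∃ y, u = f.coeff 2 * y ∧ v = f.coeff 1 * y ∧ w = f.coeff 0 * y := by
  have ha : f.coeff 2 ≠ 0 := by
    rw [← hdeg]
    exact Polynomial.leadingCoeff_ne_zero.2 fun h0 => by simp [h0] at hdeg
  -- Eliminating α² leaves a linear relation, so irrationality makes the coefficient vectors
  -- proportional.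
  obtain ⟨h1, h2⟩ := eq_zero_of_relation hirr
    (m := f.coeff 2 * v - u * f.coeff 1) (n := f.coeff 2 * w - u * f.coeff 0) (by
      push_cast
      linear_combination (f.coeff 2 : ℝ) * h - u * hroot)
  -- Since `f` has content 1, divisibility of all coefficients of u·f gives divisibility of `u`
  -- itself.
  have hdvd : Polynomial.C (f.coeff 2) ∣ Polynomial.C u * f := by
    rw [Polynomial.C_dvd_iff_dvd_coeff]
    intro i
    rw [Polynomial.coeff_C_mul]
    match i with
    | 0 => exact ⟨w, by linarith⟩
    | 1 => exact ⟨v, by linarith⟩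
    | 2 => exact ⟨u, by ring⟩
    | i + 3 => 
      rw [Polynomial.coeff_eq_zero_of_natDegree_lt (show f.natDegree < i + 3 by omega), mul_zero]
      exact dvd_zero _
  rw [← Polynomial.dvd_content_iff_C_dvd, Polynomial.content_C_mul, hf.content_eq_one, mul_one,
    dvd_normalize_iff] at hdvd
  obtain ⟨y, rfl⟩ := hdvd
  refine ⟨y, rfl, mul_left_cancel₀ ha ?_, mul_left_cancel₀ ha ?_⟩ <;> linarith

theorem discr_eq {f : Polynomial ℤ} (hdeg : f.natDegree = 2) :
    f.discr = f.coeff 1 ^ 2 - 4 * f.coeff 2 * f.coeff 0 := by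
  rw [Polynomial.discr_of_degree_eq_two
    ((Polynomial.degree_eq_iff_natDegree_eq_of_pos two_pos).2 hdeg)]
  ring

theorem aeval_quadratic {f : Polynomial ℤ} (hdeg : f.natDegree = 2) (α : ℝ) :
    Polynomial.aeval α f = f.coeff 2 * α ^ 2 + f.coeff 1 * α + f.coeff 0 := by
  rw [Polynomial.aeval_eq_sum_range, hdeg]
  simp [Finset.sum_range_succ]
  ring

theorem irrational_of_natDegree {α : ℝ} (h : (minpoly ℚ α).natDegree = 2) :
    ¬ ∃ q : ℚ, (q : ℝ) = α := by
  rintro ⟨q, rfl⟩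
  have : minpoly ℚ (q : ℝ) = Polynomial.X - Polynomial.C q := minpoly.eq_X_sub_C ℝ q
  rw [this, Polynomial.natDegree_X_sub_C] at h
  norm_num at h

theorem natDegree_minpoly_of_relation {α : ℝ} (hirr : ¬ ∃ q : ℚ, (q : ℝ) = α) {u v w : ℤ}
    (hu : u ≠ 0) (h : u * α ^ 2 + v * α + w = 0) : (minpoly ℚ α).natDegree = 2 := by
  let p : Polynomial ℚ := Polynomial.C (u : ℚ) * Polynomial.X ^ 2 +
    Polynomial.C (v : ℚ) * Polynomial.X + Polynomial.C (w : ℚ)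
  have hp : p.natDegree = 2 := Polynomial.natDegree_quadratic (by exact_mod_cast hu)
  have hp0 : p ≠ 0 := by
    intro h0
    rw [h0] at hp
    simp at hp
  have hpα : Polynomial.aeval α p = 0 := by
    simp [p]
    exact h
  have hint : IsIntegral ℚ α := (isAlgebraic_iff_isIntegral).1 ⟨p, hp0, hpα⟩
  have h1 : (minpoly ℚ α).natDegree ≤ 2 := by
    rw [← hp]
    exact Polynomial.natDegree_le_natDegree (minpoly.degree_le_of_ne_zero ℚ α hp0 hpα)
  have h2 : 0 < (minpoly ℚ α).natDegree := minpoly.natDegree_pos hint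
  have h3 : (minpoly ℚ α).natDegree ≠ 1 := by
    rw [Ne, minpoly.natDegree_eq_one_iff]
    rintro ⟨q, hq⟩
    exact hirr ⟨q, hq⟩
  omega

theorem exists_relation_of_natDegree {α : ℝ} (h : (minpoly ℚ α).natDegree = 2) :
    ∃ u v w : ℤ, u ≠ 0 ∧ u * α ^ 2 + v * α + w = 0 := by
  have hint : IsIntegral ℚ α := by
    by_contra h0
    rw [minpoly.eq_zero h0] at h
    simp at h
  have h1 := minpoly.aeval ℚ α
  have h2 : (minpoly ℚ α).coeff 2 = 1 := by
    rw [← h]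
    exact minpoly.monic hint
  rw [Polynomial.aeval_eq_sum_range, h] at h1
  simp [Finset.sum_range_succ, h2, Rat.smul_def] at h1
  set p := (minpoly ℚ α).coeff 0
  set q := (minpoly ℚ α).coeff 1
  refine ⟨p.den * q.den, q.num * p.den, p.num * q.den, ?_, ?_⟩
  · exact mul_ne_zero (by exact_mod_cast p.den_nz) (by exact_mod_cast q.den_nz)
  · have hp : (p : ℝ) = p.num / p.den := by exact_mod_cast (Rat.num_div_den p).symm
    have hq : (q : ℝ) = q.num / q.den := by exact_mod_cast (Rat.num_div_den q).symm
    have hp0 : (p.den : ℝ) ≠ 0 := by exact_mod_cast p.den_nz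
    have hq0 : (q.den : ℝ) ≠ 0 := by exact_mod_cast q.den_nz
    rw [hp, hq] at h1
    field_simp at h1
    push_cast
    linear_combination h1

theorem quadratic_case {α : ℝ} (hα : 0 < α) (h : (minpoly ℚ α).natDegree = 2) :
    Nonempty (Symm (packing α hα) ≃* Multiplicative ℤ) ∧
      ∀ f : Polynomial ℤ, f.IsPrimitive → f.natDegree = 2 → Polynomial.aeval α f = 0 →
        ((¬ ∃ x y : ℤ, x ^ 2 - f.discr * y ^ 2 = -4) →
          SymmPlus (packing α hα) = Symm (packing α hα)) ∧
        ((∃ x y : ℤ, x ^ 2 - f.discr * y ^ 2 = -4) →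
          (SymmPlus (packing α hα)).relIndex (Symm (packing α hα)) = 2) := by
  have hirr := irrational_of_natDegree h
  refine ⟨?_, fun f hprim hdeg hroot => ?_⟩
  · obtain ⟨u, v, w, hu, hroot⟩ := exists_relation_of_natDegree h
    exact nonempty_symm_mulEquiv_int hα hirr (exists_nontrivial_symm hα hirr hu hroot)
  rw [aeval_quadratic hdeg] at hroot
  rw [discr_eq hdeg]
  constructor
  · intro hno
    refine symmPlus_eq_of_forall fun Φ hΦ => ?_
    obtain ⟨ε, l, c, m, n, m', n', hform, hM⟩ := exists_form_of_mem_symm hα hirr hΦ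
    rw [hform.mem_orientationPreserving_iff]
    refine (sq_eq_one_iff.1 hform.sq_eq).resolve_right fun hε => hno ?_
    subst hε
    obtain ⟨y, h1, h2, h3⟩ := exists_multiple_of_isPrimitive hirr hprim hdeg hroot hM.relation
    have hdet : m * n' - n * m' = -1 := by exact_mod_cast hM.det
    -- The discriminant of the matrix, trace² − 4·det, is that of its quadratic relation, namely
    -- D·y².
    refine ⟨m + n', y, ?_⟩
    linear_combination 4 * hdet + (n' - m + f.coeff 1 * y) * h2
      + 4 * n * h1 - 4 * f.coeff 2 * y * h3
  · rintro ⟨x, y, hxy⟩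
    have ha : f.coeff 2 ≠ 0 := by
      rw [← hdeg]
      exact Polynomial.leadingCoeff_ne_zero.2 fun h0 => by simp [h0] at hdeg
    obtain ⟨Φ, l, d, h1, h2, -⟩ := exists_symm_of_solution hα hirr (e := -1) ha hroot
      (by norm_num) (by rw [hxy]; norm_num)
    exact relIndex_symmPlus hα hirr (by simpa using h1) h2

/-- A nonzero leading coefficient in the relation would make α quadratic; otherwise the whole
relation vanishes and the matrix is scalar. -/
theorem generic_case {α : ℝ} (hα : 0 < α) (hirr : ¬ ∃ q : ℚ, (q : ℝ) = α)
    (h : (minpoly ℚ α).natDegree ≠ 2) :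
    SymmPlus (packing α hα) = Symm (packing α hα) ∧ Symm (packing α hα) = ⊥ := by
  have hbot : Symm (packing α hα) = ⊥ := by
    rw [Subgroup.eq_bot_iff_forall]
    intro Φ hΦ
    obtain ⟨ε, l, c, m, n, m', n', hform, hM⟩ := exists_form_of_mem_symm hα hirr hΦ
    have hrel := hM.relation
    have hm' : m' = 0 := by
      by_contra hm'
      exact h (natDegree_minpoly_of_relation hirr hm' hrel)
    rw [hm', Int.cast_zero, zero_mul, zero_add] at hrel
    obtain ⟨h1, h2⟩ := eq_zero_of_relation hirr hrel
    exact (eq_one_of_hasMatrix hα hform hM (by omega) hm' (by omega)).1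
  refine ⟨?_, hbot⟩
  rw [SymmPlus, hbot, bot_inf_eq]

/-! ### The infinite dihedral group acting on a strip -/

/-- The linear part of an element of the infinite dihedral group acting on the line. -/
def dihedralSign : DihedralGroup 0 → ℤ
  | .r _ => 1
  | .sr _ => -1

/-- The translation part of an element of the infinite dihedral group acting on the line. -/
def dihedralShift : DihedralGroup 0 → ℤ
  | .r i => i
  -- `sr i` acts as translation by `i` followed by x ↦ −x.
  | .sr i => Int.neg i

/-- The sign character of the group of order two. -/
def flipSign (z : Multiplicative (ZMod 2)) : ℤ := if z = 1 then 1 else -1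

theorem dihedralSign_mul (g h : DihedralGroup 0) :
    dihedralSign (g * h) = dihedralSign g * dihedralSign h := by
  rcases g with i | i <;> rcases h with j | j <;> rfl

theorem dihedralShift_mul (g h : DihedralGroup 0) :
    dihedralShift (g * h) = dihedralSign g * dihedralShift h + dihedralShift g := by
  rcases g with i | i <;> rcases h with j | j
  · change (i + j : ℤ) = 1 * j + i
    ring
  · change -(j - i : ℤ) = 1 * -j + i
    ring
  · change -(i + j : ℤ) = -1 * j + -i
    ring
  · change (j - i : ℤ) = -1 * -j + -i
    ring

theorem dihedralSign_sq (g : DihedralGroup 0) : ((dihedralSign g : ℤ) : ℝ) ^ 2 = 1 := by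
  rcases g with i | i <;> simp [dihedralSign]

theorem dihedral_eq_one {g : DihedralGroup 0} (h : dihedralSign g = 1) (h' : dihedralShift g = 0) :
    g = 1 := by
  rcases g with i | i
  · change (i : ℤ) = 0 at h'
    exact congrArg DihedralGroup.r h'
  · simp [dihedralSign] at h

theorem exists_dihedral {e : ℤ} (he : e = 1 ∨ e = -1) (k : ℤ) :
    ∃ g, dihedralSign g = e ∧ dihedralShift g = k := by
  rcases he with rfl | rfl
  · exact ⟨.r k, rfl, rfl⟩
  · exact ⟨.sr (Int.neg k), rfl, neg_neg k⟩

theorem flipSign_mul (y z : Multiplicative (ZMod 2)) :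
    flipSign (y * z) = flipSign y * flipSign z := by
  revert y z
  decide

theorem flipSign_sq (z : Multiplicative (ZMod 2)) : ((flipSign z : ℤ) : ℝ) ^ 2 = 1 := by
  by_cases h : z = 1 <;> simp [flipSign, h]

theorem flipSign_eq_one {z : Multiplicative (ZMod 2)} (h : flipSign z = 1) : z = 1 := by
  revert z
  decide

/-- The action of `D∞ × ℤ/2` on a strip of height `2 * v` by reflections, where the translations
are by multiples of `w` and one of the vertical axes is at `u`. -/
noncomputable def stripHom (u v w : ℝ) :
    DihedralGroup 0 × Multiplicative (ZMod 2) →* Similarity where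
  toFun g := axialSimilarity (dihedralSign g.1) (flipSign g.2) 1
    (u * (1 - dihedralSign g.1) + dihedralShift g.1 * w) (v * (1 - flipSign g.2))
    (dihedralSign_sq g.1) (flipSign_sq g.2) one_pos
  map_one' := by
    ext p : 1
    have h1 : dihedralSign 1 = 1 := rfl
    have h2 : dihedralShift 1 = 0 := rfl
    have h3 : flipSign 1 = 1 := rfl
    apply plane_ext <;> simp [axialSimilarity_apply, h1, h2, h3]
  map_mul' g h := by
    ext p : 1
    rw [DilationEquiv.coe_mul, Function.comp_apply]
    apply plane_ext
    · simp [axialSimilarity_apply, dihedralSign_mul, dihedralShift_mul]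
      ring
    · simp [axialSimilarity_apply, flipSign_mul]
      ring

theorem stripHom_apply_zero (u v w : ℝ) (g : DihedralGroup 0 × Multiplicative (ZMod 2))
    (p : Plane) : stripHom u v w g p 0 =
      dihedralSign g.1 * 1 * p 0 + (u * (1 - dihedralSign g.1) + dihedralShift g.1 * w) := rfl

theorem stripHom_apply_one (u v w : ℝ) (g : DihedralGroup 0 × Multiplicative (ZMod 2))
    (p : Plane) : stripHom u v w g p 1 = flipSign g.2 * 1 * p 1 + v * (1 - flipSign g.2) := rfl

theorem stripHom_injective (u v : ℝ) {w : ℝ} (hw : w ≠ 0) :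
    Function.Injective (stripHom u v w) := by
  rw [injective_iff_map_eq_one]
  rintro ⟨g, z⟩ h
  have h0 : ∀ p, stripHom u v w (g, z) p = p := fun p => by rw [h]; rfl
  have e1 := congrArg (fun x : Plane => x 0) (h0 !₂[0, 0])
  have e2 := congrArg (fun x : Plane => x 0) (h0 !₂[1, 0])
  have e3 := congrArg (fun x : Plane => x 1) (h0 !₂[0, 0])
  have e4 := congrArg (fun x : Plane => x 1) (h0 !₂[0, 1])
  simp only [stripHom_apply_zero, stripHom_apply_one] at e1 e2 e3 e4
  simp at e1 e2 e3 e4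
  have hs : (dihedralSign g : ℝ) = 1 := by linarith
  have hf : (flipSign z : ℝ) = 1 := by
    rcases e3 with e3 | e3
    · rw [e3] at e4
      linarith
    · linarith
  have hk : (dihedralShift g : ℝ) = 0 := by
    rw [hs] at e1
    simpa [hw] using e1
  exact Prod.ext (dihedral_eq_one (by exact_mod_cast hs) (by exact_mod_cast hk))
    (flipSign_eq_one (by exact_mod_cast hf))

theorem stripHom_mem_orientationPreserving (u v w : ℝ)
    (g : DihedralGroup 0 × Multiplicative (ZMod 2)) :
    stripHom u v w g ∈ orientationPreserving ↔ dihedralSign g.1 = flipSign g.2 := by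
  rw [mem_orientationPreserving_iff one_pos (dihedralSign_sq g.1) (flipSign_sq g.2)
    (stripHom_apply_zero u v w g) (stripHom_apply_one u v w g)]
  norm_cast

/-- The elements of `D∞ × ℤ/2` acting on a strip preserving the orientation. -/
def rotationHom : DihedralGroup 0 →* DihedralGroup 0 × Multiplicative (ZMod 2) where
  -- Orientation is preserved when both coordinate signs agree, so a reflection is paired with the
  -- flip of the strip into a half-turn.
  toFun g := (g, match g with
    | .r _ => 1
    | .sr _ => Multiplicative.ofAdd 1)
  map_one' := rfl
  map_mul' g h := by
    rcases g with i | i <;> rcases h with j | j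
    · rfl
    · rfl
    · rfl
    · refine Prod.ext rfl ?_
      change (1 : Multiplicative (ZMod 2)) = Multiplicative.ofAdd 1 * Multiplicative.ofAdd 1
      decide

theorem rotationHom_injective : Function.Injective rotationHom := fun _ _ h =>
  congrArg Prod.fst h

theorem mem_range_rotationHom (g : DihedralGroup 0 × Multiplicative (ZMod 2)) :
    g ∈ rotationHom.range ↔ dihedralSign g.1 = flipSign g.2 := by
  constructor
  · rintro ⟨g | g, rfl⟩ <;> rfl
  · obtain ⟨g, z⟩ := g
    intro h
    rcases g with i | i
    · exact ⟨.r i, Prod.ext rfl (flipSign_eq_one h.symm).symm⟩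
    · refine ⟨.sr i, Prod.ext rfl ?_⟩
      change Multiplicative.ofAdd 1 = z
      change -1 = flipSign z at h
      revert z
      decide

theorem nonempty_mulEquiv_of_range {G H : Type*} [Group G] [Group H] (f : G →* H)
    (hf : Function.Injective f) {K : Subgroup H} (h : f.range = K) : Nonempty (K ≃* G) :=
  ⟨((MonoidHom.ofInjective hf).trans (MulEquiv.subgroupCongr h)).symm⟩

/-! ### Rational parameters -/

/-- The indices of a line and of a circle tangent to it in the packing with rational parameter:
the line is at height `2 * t ^ 2` and the circle is tangent to the `x`-axis at `2 * t * t₁`. -/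
structure StripData (α t t₁ : ℝ) (m₀ n₀ m₁ n₁ : ℤ) : Prop where
  pos : 0 < t
  line_s : m₀ * α + n₀ = 0
  line_t : n₀ / α = t
  circle_s : m₁ * α + n₁ = 1 / t
  circle_t : n₁ / α = t₁
  coprime_line : IsCoprime m₀ n₀
  coprime_circle : IsCoprime m₁ n₁

/-- For α = p/q in lowest terms the line has index (−q, p) and t = q; a Bézout pair ap + bq = 1
gives the index (a, b) of a circle tangent to it. -/
theorem exists_stripData {α : ℝ} (hα : 0 < α) (h : ∃ q : ℚ, (q : ℝ) = α) :
    ∃ (t t₁ : ℝ) (m₀ n₀ m₁ n₁ : ℤ), StripData α t t₁ m₀ n₀ m₁ n₁ := by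
  obtain ⟨q, rfl⟩ := h
  have hd : (0 : ℝ) < q.den := by exact_mod_cast q.den_pos
  have hq : (q : ℝ) = q.num / q.den := by exact_mod_cast (Rat.num_div_den q).symm
  have hcop : IsCoprime q.num (q.den : ℤ) := by
    rw [Int.isCoprime_iff_gcd_eq_one]
    exact q.reduced
  obtain ⟨a, b, hab⟩ := hcop
  have hab' : (a * q.num + b * q.den : ℝ) = 1 := by exact_mod_cast hab
  refine ⟨q.den, _, -q.den, q.num, a, b, hd, ?_, ?_, ?_, rfl, ?_, ?_⟩
  · rw [hq]
    push_cast
    field_simp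
    ring
  · rw [div_eq_iff hα.ne', hq]
    field_simp
  · rw [hq]
    field_simp
    linarith
  · exact ⟨-b, a, by linear_combination hab⟩
  · exact ⟨q.num, q.den, by linear_combination hab⟩

namespace StripData

variable {α t t₁ : ℝ} {m₀ n₀ m₁ n₁ : ℤ}

theorem exists_multiple (h : StripData α t t₁ m₀ n₀ m₁ n₁) {m n : ℤ} (hmn : m * α + n = 0) :
    ∃ k : ℤ, m = k * m₀ ∧ n = k * n₀ := by
  obtain ⟨a, b, hab⟩ := h.coprime_line
  have hdet : m * n₀ = m₀ * n := by
    have : (m * n₀ : ℝ) = m₀ * n := by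
      linear_combination m * h.line_s - m₀ * hmn
    exact_mod_cast this
  refine ⟨a * m + b * n, ?_, ?_⟩
  · linear_combination (-m) * hab + b * hdet
  · linear_combination (-n) * hab - a * hdet

theorem fordInt_line (h : StripData α t t₁ m₀ n₀ m₁ n₁) : fordInt α m₀ n₀ = fordVec t 0 := by
  rw [fordInt, h.line_s, h.line_t]

/-- These circles touch both lines. Consecutive ones are 2t² apart, which gives the translation step
in `stripHom`. -/
theorem fordInt_circle (h : StripData α t t₁ m₀ n₀ m₁ n₁) (k : ℤ) :
    fordInt α (m₁ + k * m₀) (n₁ + k * n₀) = fordVec (t₁ + k * t) (1 / t) := by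
  rw [fordInt, ← h.circle_s, ← h.line_t, ← h.circle_t]
  congr 1
  · push_cast; ring
  · push_cast
    linear_combination (k : ℝ) * h.line_s

theorem line_mem (h : StripData α t t₁ m₀ n₀ m₁ n₁) (hα : 0 < α) :
    fordVec t 0 ∈ orbit (baseQuad α) := by
  rw [← h.fordInt_line]
  exact fordInt_mem hα h.coprime_line

theorem circle_mem (h : StripData α t t₁ m₀ n₀ m₁ n₁) (hα : 0 < α) (k : ℤ) :
    fordVec (t₁ + k * t) (1 / t) ∈ orbit (baseQuad α) := by
  rw [← h.fordInt_circle]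
  apply fordInt_mem hα
  have ht := h.pos
  have hdet : n₀ * m₁ - n₁ * m₀ = 1 := by
    have e1 : (n₀ : ℝ) = t * α := by rw [← h.line_t]; field_simp
    have e2 : (m₀ : ℝ) = -t := by
      apply mul_right_cancel₀ hα.ne'
      linear_combination h.line_s - e1
    have e3 := h.circle_s
    field_simp at e3
    have : (n₀ * m₁ - n₁ * m₀ : ℝ) = 1 := by
      linear_combination (m₁ : ℝ) * e1 - n₁ * e2 + e3
    exact_mod_cast this
  exact ⟨n₀, -m₀, by linear_combination hdet⟩

/-- A line other than the axis has an index that is a multiple of (m₀, n₀), so its inner product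
with the known second line is 1, which distinct circles of the orbit never have. -/
theorem eq_of_isLine (h : StripData α t t₁ m₀ n₀ m₁ n₁) (hα : 0 < α) {w : Vec}
    (hw : w ∈ orbit (baseQuad α)) (h0 : w 0 = 0) : w = axisVec ∨ w = fordVec t 0 := by
  rcases eq_axisVec_or_exists hα hw h0 with h1 | ⟨m, n, -, rfl, hmn⟩
  · exact Or.inl h1
  · right
    rcases ip_orbit (isDescartes_baseQuad hα) (h.line_mem hα) hw with h1 | h1
    · exact h1
    · obtain ⟨k, rfl, rfl⟩ := h.exists_multiple hmn
      rw [← h.fordInt_line, ip_fordInt hα, show m₀ * (k * n₀) - k * m₀ * n₀ = 0 by ring] at h1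
      norm_num at h1

theorem vec_map_circle (h : StripData α t t₁ m₀ n₀ m₁ n₁)
    (g : DihedralGroup 0 × Multiplicative (ZMod 2)) {C : PlaneCircle}
    (hC : C.vec = fordVec t₁ (1 / t)) :
    (C.map (stripHom (2 * t₁ * t) (t ^ 2) (2 * t ^ 2) g)).vec =
      fordVec (t₁ + dihedralShift g.1 * t) (1 / t) := by
  have ht := h.pos
  refine vec_map_eq (k := 1) (ip_fordVec_self _ _) one_pos fun p => ?_
  rw [hC]
  simp only [powerAt, stripHom_apply_zero, stripHom_apply_one]
  simp [fordVec]
  field_simp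
  linear_combination (p 0 - 2 * t₁ * t) ^ 2 * dihedralSign_sq g.1
    + (p 1 - t ^ 2) ^ 2 * flipSign_sq g.2

theorem vec_map_xAxis (t u w : ℝ) (g : DihedralGroup 0 × Multiplicative (ZMod 2)) :
    (xAxis.map (stripHom u (t ^ 2) w g)).vec =
      if g.2 = 1 then axisVec else fordVec t 0 := by
  split_ifs with hz
  · refine vec_map_eq (k := 1) ip_axisVec_self one_pos fun p => ?_
    rw [vec_xAxis, powerAt_axisVec, powerAt_axisVec, stripHom_apply_one]
    simp [flipSign, hz]
  · refine vec_map_eq (k := 1) (ip_fordVec_self _ _) one_pos fun p => ?_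
    rw [vec_xAxis, powerAt_axisVec, powerAt, stripHom_apply_one]
    simp [flipSign, hz, fordVec]
    ring

theorem vec_map_line (t u w : ℝ) (g : DihedralGroup 0 × Multiplicative (ZMod 2)) {C : PlaneCircle}
    (hC : C.vec = fordVec t 0) :
    (C.map (stripHom u (t ^ 2) w g)).vec = if g.2 = 1 then fordVec t 0 else axisVec := by
  split_ifs with hz
  · refine vec_map_eq (k := 1) (ip_fordVec_self _ _) one_pos fun p => ?_
    rw [hC, powerAt, powerAt, stripHom_apply_one]
    simp [flipSign, hz, fordVec]
  · refine vec_map_eq (k := 1) ip_axisVec_self one_pos fun p => ?_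
    rw [hC, powerAt_axisVec, powerAt, stripHom_apply_one]
    simp [flipSign, hz, fordVec]
    ring

theorem stripHom_mem (h : StripData α t t₁ m₀ n₀ m₁ n₁) (hα : 0 < α)
    (g : DihedralGroup 0 × Multiplicative (ZMod 2)) :
    stripHom (2 * t₁ * t) (t ^ 2) (2 * t ^ 2) g ∈ Symm (packing α hα) := by
  have ht := h.pos
  have hq := isDescartes_baseQuad hα
  have hZ := future_baseQuad hα
  obtain ⟨L, hL⟩ := exists_vec_eq (ip_fordVec_self t 0)
  obtain ⟨C, hC⟩ := exists_vec_eq (ip_fordVec_self t₁ (1 / t))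
  have hC0 : fordVec t₁ (1 / t) ∈ orbit (baseQuad α) := by simpa using h.circle_mem hα 0
  have hxm : xAxis ∈ orbitCircles (baseQuad α) := by
    rw [mem_orbitCircles, vec_xAxis]; exact axisVec_mem α
  have hLm : L ∈ orbitCircles (baseQuad α) := by
    rw [mem_orbitCircles, hL]; exact h.line_mem hα
  have hCm : C ∈ orbitCircles (baseQuad α) := by
    rw [mem_orbitCircles, hC]; exact hC0
  rw [packing_eq]
  refine mem_symm_of_triple hq hZ (A := xAxis) (B := L) (C := C) ⟨?_, ?_, ?_⟩ hxm hLm hCm ?_ ?_ ?_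
  · exact extTangent_of_mem_orbit hq hZ hxm hLm (by rw [vec_xAxis, hL, ip_axisVec_fordVec])
  · refine extTangent_of_mem_orbit hq hZ hLm hCm ?_
    rw [hL, hC, ip_fordVec]
    field_simp
    ring
  · exact extTangent_of_mem_orbit hq hZ hxm hCm (by rw [vec_xAxis, hC, ip_axisVec_fordVec])
  · rw [mem_orbitCircles, vec_map_xAxis]
    split_ifs
    · exact axisVec_mem α
    · exact h.line_mem hα
  · rw [mem_orbitCircles, vec_map_line _ _ _ _ hL]
    split_ifs
    · exact h.line_mem hα
    · exact axisVec_mem α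
  · rw [mem_orbitCircles, h.vec_map_circle g hC]
    exact h.circle_mem hα _

theorem mem_range_of_map_xAxis (h : StripData α t t₁ m₀ n₀ m₁ n₁) (hα : 0 < α) {Φ : Similarity}
    (hΦ : Φ ∈ Symm (packing α hα)) (hx : xAxis.map Φ = xAxis) :
    Φ ∈ (stripHom (2 * t₁ * t) (t ^ 2) (2 * t ^ 2)).range := by
  have ht := h.pos
  obtain ⟨ε, l, c, hf⟩ := hasAxialForm_of_map_xAxis hx
  have hl := hf.pos
  -- The second line must map to a line of the packing and cannot map to the axis, so its height is
  -- preserved.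
  have hl1 : l = 1 := by
    obtain ⟨L, hL⟩ := exists_vec_eq (ip_fordVec_self t 0)
    have hLm : L ∈ packing α hα := by
      rw [packing_eq, mem_orbitCircles, hL]; exact h.line_mem hα
    have hmem := map_mem_of_mem_symm hΦ hLm
    rw [packing_eq, mem_orbitCircles] at hmem
    have hline : (L.map Φ).vec 0 = 0 := by
      rw [← isLine_iff, isLine_map, isLine_iff, hL]
      simp [fordVec]
    rcases h.eq_of_isLine hα hmem hline with he | he
    · exfalso
      rw [hf.vec_map hL] at he
      have := congrFun he 3
      simp [fordVec, axisVec] at this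
      norm_num at this
    · rw [hf.vec_map hL] at he
      have e1 := congrFun he 1
      simp [fordVec] at e1
      field_simp at e1
      rw [hf.sq_eq] at e1
      exact ((sq_eq_one_iff.1 e1.symm).resolve_right (by linarith))
  subst hl1
  obtain ⟨m, n, h1, h2⟩ := hf.exists_image hα hΦ h.coprime_circle
    (by rw [h.circle_s]; positivity)
  rw [h.circle_s, h.circle_t] at h1
  rw [one_mul] at h2
  -- The image circle has the same curvature, so its index differs from (m₁, n₁) by a multiple of
  -- the line's index; this is the translation part.
  obtain ⟨k, hk, hk'⟩ := h.exists_multiple (m := m - m₁) (n := n - n₁) (by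
    push_cast
    linear_combination h2)
  have hn : (n : ℝ) / α = t₁ + k * t := by
    obtain rfl : n = n₁ + k * n₀ := by linarith
    rw [← h.circle_t, ← h.line_t]
    push_cast
    ring
  rw [hn] at h1
  obtain ⟨e, he, heε⟩ : ∃ e : ℤ, (e = 1 ∨ e = -1) ∧ (e : ℝ) = ε := by
    rcases sq_eq_one_iff.1 hf.sq_eq with rfl | rfl
    · exact ⟨1, Or.inl rfl, by norm_num⟩
    · exact ⟨-1, Or.inr rfl, by norm_num⟩
  obtain ⟨g, hg1, hg2⟩ := exists_dihedral he k
  refine ⟨(g, 1), ?_⟩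
  ext p : 1
  apply plane_ext
  · rw [stripHom_apply_zero, hf.apply_zero, hg1, hg2, heε]
    field_simp at h1
    linear_combination h1
  · rw [stripHom_apply_one, hf.apply_one]
    simp [flipSign]

/-- A symmetry exchanging the two lines is composed with the flip of the strip, which reduces to the
case where the axis is fixed. -/
theorem range_stripHom (h : StripData α t t₁ m₀ n₀ m₁ n₁) (hα : 0 < α) :
    (stripHom (2 * t₁ * t) (t ^ 2) (2 * t ^ 2)).range = Symm (packing α hα) := by
  apply le_antisymm
  · rintro _ ⟨g, rfl⟩
    exact h.stripHom_mem hα g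
  · intro Φ hΦ
    have hxm : xAxis ∈ packing α hα := by
      rw [packing_eq, mem_orbitCircles, vec_xAxis]; exact axisVec_mem α
    have hmem := map_mem_of_mem_symm hΦ hxm
    rw [packing_eq, mem_orbitCircles] at hmem
    have hline : (xAxis.map Φ).vec 0 = 0 := by
      rw [← isLine_iff, isLine_map, isLine_iff, vec_xAxis]
      rfl
    rcases h.eq_of_isLine hα hmem hline with he | he
    · exact h.mem_range_of_map_xAxis hα hΦ (vec_injective (he.trans vec_xAxis.symm))
    · have hz : (Multiplicative.ofAdd 1 : Multiplicative (ZMod 2)) ≠ 1 := by decide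
      let F := stripHom (2 * t₁ * t) (t ^ 2) (2 * t ^ 2) (1, Multiplicative.ofAdd 1)
      have hF : F ∈ Symm (packing α hα) := h.stripHom_mem hα _
      have hFΦ : F * Φ ∈ (stripHom (2 * t₁ * t) (t ^ 2) (2 * t ^ 2)).range := by
        refine h.mem_range_of_map_xAxis hα (mul_mem hF hΦ) (vec_injective ?_)
        rw [PlaneCircle.map_mul, vec_map_line _ _ _ _ he, if_neg hz, vec_xAxis]
      have hFr : F ∈ (stripHom (2 * t₁ * t) (t ^ 2) (2 * t ^ 2)).range := ⟨_, rfl⟩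
      exact (Subgroup.mul_mem_cancel_left _ hFr).1 hFΦ

theorem range_comp_rotationHom (h : StripData α t t₁ m₀ n₀ m₁ n₁) (hα : 0 < α) :
    ((stripHom (2 * t₁ * t) (t ^ 2) (2 * t ^ 2)).comp rotationHom).range =
      SymmPlus (packing α hα) := by
  ext Φ
  rw [SymmPlus, Subgroup.mem_inf, ← h.range_stripHom hα]
  constructor
  · rintro ⟨g, rfl⟩
    exact ⟨⟨_, rfl⟩, (stripHom_mem_orientationPreserving _ _ _ _).2
      ((mem_range_rotationHom _).1 ⟨g, rfl⟩)⟩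
  · rintro ⟨⟨g, rfl⟩, hg⟩
    obtain ⟨k, rfl⟩ := (mem_range_rotationHom g).2
      ((stripHom_mem_orientationPreserving _ _ _ _).1 hg)
    exact ⟨k, rfl⟩

theorem isStripPacking (h : StripData α t t₁ m₀ n₀ m₁ n₁) (hα : 0 < α) :
    IsStripPacking (packing α hα) := by
  have ht := h.pos
  have hq := isDescartes_baseQuad hα
  have hZ := future_baseQuad hα
  rw [packing_eq]
  refine ⟨isApollonianPacking_orbitCircles hq hZ, ?_⟩
  obtain ⟨L, hL⟩ := exists_vec_eq (ip_fordVec_self t 0)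
  have hxm : xAxis ∈ orbitCircles (baseQuad α) := by
    rw [mem_orbitCircles, vec_xAxis]; exact axisVec_mem α
  have hLm : L ∈ orbitCircles (baseQuad α) := by
    rw [mem_orbitCircles, hL]; exact h.line_mem hα
  -- The powers with respect to two circles of the packing have nonnegative sum, so no point of the
  -- closed side of one lies in the interior of the other.
  have key : ∀ A ∈ orbitCircles (baseQuad α), ∀ C ∈ orbitCircles (baseQuad α), C ≠ A →
      ∀ p, p ∈ C.curve ∪ C.interior → p ∉ A.interior := by
    intro A hA C hC hne p hp hpA
    have hfut := future_add_of_mem_orbit hq hZ hA hC fun he => hne (vec_injective he)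
    have h1 := hfut.powerAt_nonneg p
    rw [powerAt_add] at h1
    rw [A.represents.mem_interior] at hpA
    rcases hp with hp | hp
    · rw [C.represents.mem_curve] at hp
      linarith
    · rw [C.represents.mem_interior] at hp
      linarith
  refine ⟨xAxis, hxm, L, hLm, ?_, ?_, ?_, fun C hC h1 h2 p hp => ?_⟩
  · rw [isLine_iff, vec_xAxis]; rfl
  · rw [isLine_iff, hL]; simp [fordVec]
  · rw [Set.disjoint_left]
    intro p h1 h2
    rw [xAxis.represents.mem_curve, vec_xAxis, powerAt_axisVec] at h1
    rw [L.represents.mem_curve, hL, powerAt] at h2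
    simp [fordVec] at h2
    nlinarith [pow_pos ht 2]
  · rintro (hx | hx)
    · exact key xAxis hxm C hC h1 p hp hx
    · exact key L hLm C hC h2 p hp hx

end StripData

theorem rational_case {α : ℝ} (hα : 0 < α) (h : ∃ q : ℚ, (q : ℝ) = α) :
    IsStripPacking (packing α hα) ∧
      Nonempty (Symm (packing α hα) ≃* DihedralGroup 0 × Multiplicative (ZMod 2)) ∧
      Nonempty (SymmPlus (packing α hα) ≃* DihedralGroup 0) := by
  obtain ⟨t, t₁, m₀, n₀, m₁, n₁, hd⟩ := exists_stripData hα h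
  have ht := hd.pos
  have hinj := stripHom_injective (2 * t₁ * t) (t ^ 2) (w := 2 * t ^ 2) (by positivity)
  exact ⟨hd.isStripPacking hα,
    nonempty_mulEquiv_of_range _ hinj (hd.range_stripHom hα),
    nonempty_mulEquiv_of_range ((stripHom (2 * t₁ * t) (t ^ 2) (2 * t ^ 2)).comp rotationHom)
      (by
        rw [MonoidHom.coe_comp]
        exact hinj.comp rotationHom_injective)
      (hd.range_comp_rotationHom hα)⟩

end Apollonian

theorem theorem2 (α : ℝ) (hα : 0 < α) :
    ((∃ q : ℚ, (q : ℝ) = α) →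
      Apollonian.IsStripPacking (Apollonian.packing α hα) ∧
      Nonempty (Apollonian.Symm (Apollonian.packing α hα) ≃*
        DihedralGroup 0 × Multiplicative (ZMod 2)) ∧
      Nonempty (Apollonian.SymmPlus (Apollonian.packing α hα) ≃* DihedralGroup 0)) ∧
    ((minpoly ℚ α).natDegree = 2 →
      Nonempty (Apollonian.Symm (Apollonian.packing α hα) ≃* Multiplicative ℤ) ∧
      ∀ f : Polynomial ℤ, f.IsPrimitive → f.natDegree = 2 → Polynomial.aeval α f = 0 →
        ((¬ ∃ x y : ℤ, x ^ 2 - f.discr * y ^ 2 = -4) →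
          Apollonian.SymmPlus (Apollonian.packing α hα) =
            Apollonian.Symm (Apollonian.packing α hα)) ∧
        ((∃ x y : ℤ, x ^ 2 - f.discr * y ^ 2 = -4) →
          (Apollonian.SymmPlus (Apollonian.packing α hα)).relIndex
            (Apollonian.Symm (Apollonian.packing α hα)) = 2)) ∧
    ((¬ ∃ q : ℚ, (q : ℝ) = α) → (minpoly ℚ α).natDegree ≠ 2 →
      Apollonian.SymmPlus (Apollonian.packing α hα) =
          Apollonian.Symm (Apollonian.packing α hα) ∧
        Apollonian.Symm (Apollonian.packing α hα) = ⊥) := by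
  exact ⟨Apollonian.rational_case hα, Apollonian.quadratic_case hα, Apollonian.generic_case hα⟩
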